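/- Let $L$ be an even lattice of signature $(p,q)$ with $p\le q$, put $\sigma(L)=p-q$, and let $I\subset L$ be a primitive isotropic sublattice of rank $p$. Let $A_L=L^\vee/L$ be the discriminant group with $q_L(\lambda)=(\lambda,\lambda)/2\in\mathbb{Q}/\mathbb{Z}$, and write $e(x)=\exp(2\pi i x)$. Let $\rho_L$ be the Weil representation of $\mathrm{Mp}_2(\mathbb{Z})$ on $\mathbb{C}A_L$, determined by $$\rho_L(T)\mathbf{e}_\lambda=e(q_L(\lambda))\mathbf{e}_\lambda,\qquad \rho_L(S)\mathbf{e}_\lambda=\frac{e(-\sigma(L)/8)}{\sqrt{|A_L|}}\sum_{\mu\in A_L}e(-(\lambda,\mu))\mathbf{e}_\mu ,$$ where $T=\left(\begin{pmatrix}1&1\\0&1\end{pmatrix},1\right)$ and $S=\left(\begin{pmatrix}0&-1\\1&0\end{pmatrix},\sqrt{\tau}\right)$. Let $M^!(L)$ be the space of weakly holomorphic modular forms of weight $\sigma(L)/2$ and type $\rho_L$, that is, of holomorphic functions $f$ from the upper half plane to $\mathbb{C}A_L$ with $f(M\tau)=\phi(\tau)^{\sigma(L)}\rho_L(M,\phi)f(\tau)$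 for all $(M,\phi)\in\mathrm{Mp}_2(\mathbb{Z})$ which are meromorphic at the cusp. They have Fourier expansions $f=\sum_{\lambda\in A_L}\sum_{n\in q_L(\lambda)+\mathbb{Z}}c_\lambda(n)q^n\mathbf{e}_\lambda$ with finitely many nonzero $c_\lambda(n)$ for $n<0$. Let $I^*=I_{\mathbb{Q}}\cap L^\vee$, let $L^*=L+I^*$ (an even overlattice of $L$), and let $K=(I^\perp\cap L)/I$, a negative definite even lattice; let $K^+=K(-1)$. There is a canonical isometry $A_{L^*}\cong A_K$, sending the class of $y\in (L^*)^\vee\cap I_{\mathbb{Q}}^\perp$ to the class of $y$ modulo $I_{\mathbb{Q}}$. Let $\downarrow^L_K\colon\mathbb{C}A_L\to\mathbb{C}A_{L^*}=\mathbb{C}A_K$ be the linear map which sends $\mathbf{e}_\mu$ to $\mathbf{e}_{p(\mu)}$ if $\mu\in (L^*)^\vee/L$, where $p\colon(L^*)^\vee/L\to A_{L^*}$ is the projection, and to $0$ otherwise. Let $\Theta_{K^+}(\tau)=\sum_{l\in (K^+)^\vee}q^{(l,l)/2}\mathbf{e}_{[l]}$, with values in $\mathbb{C}A_{K^+}=(\mathbb{C}A_K)^\vee$.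 For $f_1,f_2\in M^!(L)$ the $\Theta$-product with respect to $I$ is $$f_1\ast f_2=\langle f_1{\downarrow^L_K},\Theta_{K^+}\rangle\cdot f_2 .$$ Then $M^!(L)$, with pointwise addition and $\ast$, is an associative ring (not necessarily commutative or with a unit element), and the group $M^!(L)'_{\mathbb{Z}}$ of those $f\in M^!(L)$ all of whose Fourier coefficients $c_\lambda(n)$ are integers is closed under $\ast$. Hence $M^!(L)'_{\mathbb{Z}}$ is a subring of $M^!(L)$. -/

import Mathlib

open scoped UpperHalfPlane MatrixGroups Manifold

namespace ThetaProduct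

noncomputable section

/-- The function `e(x) = exp(2πix)`. -/
def e (x : ℂ) : ℂ := Complex.exp (2 * (Real.pi : ℂ) * Complex.I * x)

/-! ### The metaplectic group -/

/-- The metaplectic double cover `Mp₂(ℤ)` of `SL₂(ℤ)`: pairs `(M, φ)` with
`M = (a b; c d) ∈ SL₂(ℤ)` and `φ` holomorphic on the upper half plane, `φ(τ)² = cτ + d`. -/
@[ext]
structure Mp2Z where
  mat : SL(2, ℤ)
  phi : ℍ → ℂ
  holo : MDiff phi
  sq : ∀ τ : ℍ, phi τ ^ 2 = UpperHalfPlane.denom mat τ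

namespace Mp2Z

lemma phi_ne_zero (g : Mp2Z) (τ : ℍ) : g.phi τ ≠ 0 := by
  intro h
  have h1 := g.sq τ
  rw [h, zero_pow two_ne_zero] at h1
  exact UpperHalfPlane.denom_ne_zero _ _ h1.symm

lemma denom_mul (M N : SL(2, ℤ)) (τ : ℍ) :
    UpperHalfPlane.denom (M * N : SL(2, ℤ)) τ =
      UpperHalfPlane.denom M ((N • τ : ℍ) : ℂ) * UpperHalfPlane.denom N τ := by
  have h := UpperHalfPlane.denom_cocycle_σ (M : GL (Fin 2) ℝ) (N : GL (Fin 2) ℝ) τ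
  have hσ : UpperHalfPlane.σ (N : GL (Fin 2) ℝ) = ContinuousAlgEquiv.refl ℝ ℂ := by
    simp [UpperHalfPlane.σ]
  rw [hσ] at h
  rw [map_mul, map_mul]
  exact h

lemma mdiff_smul (M : SL(2, ℤ)) : MDiff (fun τ : ℍ => M • τ) := by
  have h : (0 : ℝ) < ((M : GL (Fin 2) ℝ)).det.val := by simp
  exact UpperHalfPlane.mdifferentiable_smul h

/-- `(M, φ(τ)) (N, ψ(τ)) = (MN, φ(Nτ)ψ(τ))`. -/
instance : Mul Mp2Z where
  mul g h :=
    { mat := g.mat * h.mat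
      phi := fun τ => g.phi (h.mat • τ) * h.phi τ
      holo := (g.holo.comp (mdiff_smul h.mat)).mul h.holo
      sq := fun τ => by rw [mul_pow, g.sq, h.sq, denom_mul] }

instance : One Mp2Z where
  one :=
    { mat := 1
      phi := fun _ => 1
      holo := mdifferentiable_const
      sq := fun τ => by simp [UpperHalfPlane.denom_one] }

instance : Inv Mp2Z where
  inv g :=
    { mat := g.mat⁻¹
      phi := fun τ => (g.phi (g.mat⁻¹ • τ))⁻¹
      holo := by
        have h := g.holo.comp (mdiff_smul g.mat⁻¹)
        rw [UpperHalfPlane.mdifferentiable_iff] at h ⊢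
        exact h.inv (fun z _ => g.phi_ne_zero _)
      sq := fun τ => by
        rw [inv_pow, g.sq]
        have h := denom_mul g.mat g.mat⁻¹ τ
        rw [mul_inv_cancel] at h
        have h1 : UpperHalfPlane.denom ((1 : SL(2, ℤ)) : GL (Fin 2) ℝ) (τ : ℂ) = 1 := by
          simp [UpperHalfPlane.denom_one]
        rw [h1] at h
        exact inv_eq_of_mul_eq_one_right h.symm }

@[simp] lemma mul_mat (g h : Mp2Z) : (g * h).mat = g.mat * h.mat := rfl
@[simp] lemma mul_phi (g h : Mp2Z) (τ : ℍ) :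
    (g * h).phi τ = g.phi (h.mat • τ) * h.phi τ := rfl
@[simp] lemma one_mat : (1 : Mp2Z).mat = 1 := rfl
@[simp] lemma one_phi (τ : ℍ) : (1 : Mp2Z).phi τ = 1 := rfl
@[simp] lemma inv_mat (g : Mp2Z) : (g⁻¹).mat = g.mat⁻¹ := rfl
@[simp] lemma inv_phi (g : Mp2Z) (τ : ℍ) :
    (g⁻¹).phi τ = (g.phi (g.mat⁻¹ • τ))⁻¹ := rfl

instance : Group Mp2Z where
  mul_assoc a b c := by
    refine Mp2Z.ext (mul_assoc _ _ _) (funext fun τ => ?_)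
    simp only [mul_phi, mul_mat, mul_smul, mul_assoc]
  one_mul a := by
    refine Mp2Z.ext (one_mul _) (funext fun τ => ?_)
    simp only [mul_phi, one_phi, one_mul]
  mul_one a := by
    refine Mp2Z.ext (mul_one _) (funext fun τ => ?_)
    simp only [mul_phi, one_phi, one_mat, one_smul, mul_one]
  inv_mul_cancel a := by
    refine Mp2Z.ext (inv_mul_cancel _) (funext fun τ => ?_)
    simp only [mul_phi, inv_phi, one_phi, inv_smul_smul]
    exact inv_mul_cancel₀ (a.phi_ne_zero τ)

/-- `T = ((1 1; 0 1), 1)`. -/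
def T : Mp2Z where
  mat := ModularGroup.T
  phi := fun _ => 1
  holo := mdifferentiable_const
  sq := fun τ => by rw [ModularGroup.denom_apply]; simp [ModularGroup.T]

/-- `S = ((0 -1; 1 0), √τ)`, with the principal branch of the square root. -/
def S : Mp2Z where
  mat := ModularGroup.S
  phi := fun τ => (τ : ℂ) ^ (1 / 2 : ℂ)
  holo := by
    rw [UpperHalfPlane.mdifferentiable_iff]
    have h : DifferentiableOn ℂ (fun z : ℂ => z ^ (1 / 2 : ℂ)) {z | 0 < z.im} := fun z hz =>
      (differentiableAt_id.cpow_const (Or.inr (ne_of_gt hz))).differentiableWithinAt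
    exact h.congr fun z hz => by simp [UpperHalfPlane.ofComplex_apply_of_im_pos hz]
  sq := fun τ => by
    rw [ModularGroup.denom_S, ← Complex.cpow_nat_mul]
    norm_num

end Mp2Z

/-! ### Lattices, discriminant groups and the Weil representation -/

section Basic

variable {V : Type*} [AddCommGroup V] [Module ℚ V]

/-- The discriminant group `A_N = N^∨ / N`, where `N^∨ = {x | (x, N) ⊆ ℤ}`. -/
abbrev Disc (B : LinearMap.BilinForm ℚ V) (N : Submodule ℤ V) : Type _ :=
  ↥(B.dualSubmodule N) ⧸ N.submoduleOf (B.dualSubmodule N)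

/-- A vector of `N^∨` that represents a given class of `A_N`. -/
def rep {B : LinearMap.BilinForm ℚ V} {N : Submodule ℤ V} (a : Disc B N) : V :=
  (Quotient.out a : ↥(B.dualSubmodule N))

/-- The class in `A_N` of a vector of `N^∨`. -/
def cls (B : LinearMap.BilinForm ℚ V) (N : Submodule ℤ V) (x : V)
    (hx : x ∈ B.dualSubmodule N) : Disc B N :=
  Submodule.Quotient.mk ⟨x, hx⟩

/-- The operator `ρ_N(T)` on the group ring `ℂA_N`: `e_λ ↦ e(q(λ)) e_λ`, where
`q(λ) = (λ, λ)/2 ∈ ℚ/ℤ`. -/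
def weilT (B : LinearMap.BilinForm ℚ V) (N : Submodule ℤ V) :
    Module.End ℂ (Disc B N →₀ ℂ) :=
  Finsupp.linearCombination ℂ fun a =>
    e ((B (rep a) (rep a) / 2 : ℚ) : ℂ) • Finsupp.single a (1 : ℂ)

/-- The operator `ρ_N(S)` on `ℂA_N`:
`e_λ ↦ e(-σ/8) |A_N|^{-1/2} ∑_μ e(-(λ, μ)) e_μ`, where `σ` is the signature of `N`. -/
def weilS (B : LinearMap.BilinForm ℚ V) (N : Submodule ℤ V) (σ : ℤ) :
    Module.End ℂ (Disc B N →₀ ℂ) :=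
  Finsupp.linearCombination ℂ fun a =>
    (e (-(σ : ℂ) / 8) / (Real.sqrt (Nat.card (Disc B N)) : ℂ)) •
      ∑ᶠ b : Disc B N, e (-((B (rep a) (rep b) : ℚ) : ℂ)) • Finsupp.single b (1 : ℂ)

/-- The graph `{(g, ρ_N(g))}` of the Weil representation of `Mp₂(ℤ)` on `ℂA_N`, i.e. of the
multiplicative extension of `T ↦ ρ_N(T)`, `S ↦ ρ_N(S)`. (`S` and `T` generate `Mp₂(ℤ)` even as
a monoid, because `S` and `ST` have finite order.) -/
def weilGraph (B : LinearMap.BilinForm ℚ V) (N : Submodule ℤ V) (σ : ℤ) :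
    Submonoid (Mp2Z × Module.End ℂ (Disc B N →₀ ℂ)) :=
  Submonoid.closure {(Mp2Z.T, weilT B N), (Mp2Z.S, weilS B N σ)}

/-- `f = ∑_λ ∑_{n ∈ q(λ) + ℤ} c_λ(n) q^n e_λ` on the upper half plane, with only finitely many
nonzero coefficients for negative `n`. -/
structure HasFourierExpansion (B : LinearMap.BilinForm ℚ V) (N : Submodule ℤ V)
    (f : ℍ → (Disc B N →₀ ℂ)) (c : Disc B N → ℚ → ℂ) : Prop where
  support : ∀ a n, c a n ≠ 0 → ∃ m : ℤ, n = B (rep a) (rep a) / 2 + m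
  bddBelow : ∃ n₀ : ℚ, ∀ a n, n < n₀ → c a n = 0
  hasSum : ∀ a (τ : ℍ), HasSum (fun n : ℚ => c a n * e ((n : ℂ) * (τ : ℂ))) (f τ a)

/-- `f` is a weakly holomorphic modular form of weight `k = w/2` and type `ρ_N`, where `σ` is the
signature of `N`: it is holomorphic, `f(Mτ) = φ(τ)^{2k} ρ_N(M, φ) f(τ)` for all
`(M, φ) ∈ Mp₂(ℤ)`, and it is meromorphic at the cusp. -/
structure IsWeaklyHolomorphicModularForm (B : LinearMap.BilinForm ℚ V) (N : Submodule ℤ V)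
    (σ w : ℤ) (f : ℍ → (Disc B N →₀ ℂ)) : Prop where
  holo : ∀ a, MDiff (fun τ : ℍ => f τ a)
  modular : ∀ (g : Mp2Z) (ρg : Module.End ℂ (Disc B N →₀ ℂ)), (g, ρg) ∈ weilGraph B N σ →
    ∀ τ : ℍ, f (g.mat • τ) = (g.phi τ ^ w) • ρg (f τ)
  meromorphic : ∃ c, HasFourierExpansion B N f c

/-- The coset theta series `∑_{l ∈ λ + N} q^{(l, l)/2}`, i.e. the `λ`-component of the theta
series `Θ_N` of a positive definite lattice `N`. -/
def theta (B : LinearMap.BilinForm ℚ V) (N : Submodule ℤ V) (τ : ℍ) (a : Disc B N) : ℂ :=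
  ∑' l : {l : ↥(B.dualSubmodule N) // (Submodule.Quotient.mk l : Disc B N) = a},
    e (((B l.1 l.1 / 2 : ℚ) : ℂ) * (τ : ℂ))

open Classical in
/-- The pushforward `↓ : ℂA_N → ℂA_{N'}` for an overlattice `N ⊆ N' ⊆ N^∨`. With `J = N'/N`, so
`J^⊥ = N'^∨/N ⊆ A_N`, it maps `e_μ` to `e_{p(μ)}` for `μ ∈ J^⊥`, with `p : J^⊥ → A_{N'}` the
projection, and to `0` for `μ ∉ J^⊥`. -/
def pushforward (B : LinearMap.BilinForm ℚ V) (N N' : Submodule ℤ V) :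
    (Disc B N →₀ ℂ) →ₗ[ℂ] (Disc B N' →₀ ℂ) :=
  Finsupp.linearCombination ℂ fun a =>
    if h : rep a ∈ B.dualSubmodule N' then Finsupp.single (cls B N' (rep a) h) 1 else 0

lemma dualSubmodule_le_neg (B : LinearMap.BilinForm ℚ V) (N : Submodule ℤ V) :
    B.dualSubmodule N ≤ (-B).dualSubmodule N := fun x hx y hy => by
  simpa using neg_mem (hx y hy)

/-- The identification of abelian groups `A_N = A_{N(-1)}`. -/
def discNeg (B : LinearMap.BilinForm ℚ V) (N : Submodule ℤ V) :
    Disc B N →ₗ[ℤ] Disc (-B) N :=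
  Submodule.mapQ _ _ (Submodule.inclusion (dualSubmodule_le_neg B N)) fun _ hx => hx

end Basic

/-- An even lattice, as a full lattice in the rational quadratic space `V = L_ℚ`. -/
structure EvenLattice (V : Type*) [AddCommGroup V] [Module ℚ V] where
  form : LinearMap.BilinForm ℚ V
  lat : Submodule ℤ V
  symm : form.IsSymm
  nondegenerate : form.Nondegenerate
  fg : lat.FG
  span_eq_top : Submodule.span ℚ (lat : Set V) = ⊤
  integral : ∀ x ∈ lat, ∀ y ∈ lat, ∃ m : ℤ, form x y = m
  even : ∀ x ∈ lat, ∃ m : ℤ, form x x = 2 * m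

namespace EvenLattice

variable {V : Type*} [AddCommGroup V] [Module ℚ V] (L : EvenLattice V)

/-- `p` for a lattice of signature `(p, q)`. -/
def sigPos : ℕ := _root_.sigPos L.form.toQuadraticMap

/-- `q` for a lattice of signature `(p, q)`. -/
def sigNeg : ℕ := _root_.sigNeg L.form.toQuadraticMap

/-- `σ(L) = p - q`. -/
def sigma : ℤ := (L.sigPos : ℤ) - L.sigNeg

/-- The discriminant group `A_L = L^∨/L`. -/
abbrev A : Type _ := Disc L.form L.lat

/-- The space `M^!(L)` of weakly holomorphic modular forms of weight `σ(L)/2` and type `ρ_L`. -/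
def forms : Submodule ℂ (ℍ → (L.A →₀ ℂ)) where
  carrier := {f | IsWeaklyHolomorphicModularForm L.form L.lat L.sigma L.sigma f}
  zero_mem' :=
    { holo := fun a => mdifferentiable_const
      modular := fun g ρg _ τ => by simp
      meromorphic := ⟨0, by simp, ⟨0, by simp⟩, fun a τ => by simp⟩ }
  add_mem' := by
    rintro f g ⟨hf, hf', cf, hcf⟩ ⟨hg, hg', cg, hcg⟩
    refine ⟨fun a => (hf a).add (hg a), fun x ρx hx τ => ?_, cf + cg, ?_, ?_, ?_⟩
    · simp only [Pi.add_apply, hf' x ρx hx, hg' x ρx hx, map_add, smul_add]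
    · intro a n h
      by_cases h1 : cf a n = 0
      · exact hcg.support a n (by simpa [h1] using h)
      · exact hcf.support a n h1
    · obtain ⟨n₁, h₁⟩ := hcf.bddBelow
      obtain ⟨n₂, h₂⟩ := hcg.bddBelow
      exact ⟨min n₁ n₂, fun a n hn => by
        simp [h₁ a n (hn.trans_le (min_le_left _ _)), h₂ a n (hn.trans_le (min_le_right _ _))]⟩
    · intro a τ
      simpa [add_mul] using (hcf.hasSum a τ).add (hcg.hasSum a τ)
  smul_mem' := by
    rintro r f ⟨hf, hf', cf, hcf⟩
    refine ⟨fun a => ?_, fun x ρx hx τ => ?_, fun a n => r * cf a n, ?_, ?_, ?_⟩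
    · exact (mdifferentiable_const (c := r)).mul (hf a)
    · simp only [Pi.smul_apply, hf' x ρx hx, map_smul]
      exact smul_comm _ _ _
    · intro a n h
      exact hcf.support a n (right_ne_zero_of_mul h)
    · obtain ⟨n₁, h₁⟩ := hcf.bddBelow
      exact ⟨n₁, fun a n hn => by simp [h₁ a n hn]⟩
    · intro a τ
      simpa [mul_assoc] using (hcf.hasSum a τ).mul_left r

/-- The group `M^!(L)'_ℤ` of those `f ∈ M^!(L)` all of whose Fourier coefficients are integers. -/
def integralForms : AddSubgroup (ℍ → (L.A →₀ ℂ)) where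
  carrier := {f | f ∈ L.forms ∧
    ∃ c : L.A → ℚ → ℤ, HasFourierExpansion L.form L.lat f fun a n => (c a n : ℂ)}
  zero_mem' := ⟨zero_mem _, 0, by simp, ⟨0, by simp⟩, fun a τ => by simp⟩
  add_mem' := by
    rintro f g ⟨hf, cf, hcf⟩ ⟨hg, cg, hcg⟩
    refine ⟨add_mem hf hg, cf + cg, ?_, ?_, ?_⟩
    · intro a n h
      by_cases h1 : cf a n = 0
      · exact hcg.support a n (by simpa [h1] using h)
      · exact hcf.support a n (by exact_mod_cast h1)
    · obtain ⟨n₁, h₁⟩ := hcf.bddBelow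
      obtain ⟨n₂, h₂⟩ := hcg.bddBelow
      refine ⟨min n₁ n₂, fun a n hn => ?_⟩
      have e₁ := h₁ a n (hn.trans_le (min_le_left _ _))
      have e₂ := h₂ a n (hn.trans_le (min_le_right _ _))
      simp only [Pi.add_apply, Int.cast_add, e₁, e₂, add_zero]
    · intro a τ
      simpa [add_mul] using (hcf.hasSum a τ).add (hcg.hasSum a τ)
  neg_mem' := by
    rintro f ⟨hf, cf, hcf⟩
    refine ⟨neg_mem hf, -cf, ?_, ?_, ?_⟩
    · intro a n h
      exact hcf.support a n (by simpa using h)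
    · obtain ⟨n₁, h₁⟩ := hcf.bddBelow
      exact ⟨n₁, fun a n hn => by simpa using h₁ a n hn⟩
    · intro a τ
      simpa using (hcf.hasSum a τ).neg

/-- The value `e(q(λ))` does not depend on the representative of `λ`. -/
lemma e_quad_rep (x : V) (hx : x ∈ L.form.dualSubmodule L.lat) :
    e ((L.form (rep (cls L.form L.lat x hx)) (rep (cls L.form L.lat x hx)) / 2 : ℚ) : ℂ) =
      e ((L.form x x / 2 : ℚ) : ℂ) := by
  set y := rep (cls L.form L.lat x hx) with hy
  have hyx : y - x ∈ L.lat := by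
    have h := (Submodule.Quotient.eq (L.lat.submoduleOf (L.form.dualSubmodule L.lat))).1
      (Quotient.out_eq (cls L.form L.lat x hx))
    exact h
  obtain ⟨m, hm⟩ := L.even _ hyx
  obtain ⟨k, hk⟩ := Submodule.mem_one.1 (hx _ hyx)
  have hk' : L.form x (y - x) = k := hk.symm
  have h : L.form y y = L.form x x + 2 * k + 2 * m := by
    have h1 : y = x + (y - x) := by abel
    have h2 : L.form (y - x) x = k := by rw [L.symm.eq]; exact hk'
    rw [h1, LinearMap.BilinForm.add_left, LinearMap.BilinForm.add_right,
      LinearMap.BilinForm.add_right, hm, hk', h2]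
    ring
  have h3 : ((L.form y y / 2 : ℚ) : ℂ) = ((L.form x x / 2 : ℚ) : ℂ) + ((k + m : ℤ) : ℂ) := by
    rw [h]; push_cast; ring
  rw [h3, e, e, mul_add, Complex.exp_add]
  have h4 : Complex.exp (2 * (Real.pi : ℂ) * Complex.I * ((k + m : ℤ) : ℂ)) = 1 := by
    rw [mul_comm]; exact Complex.exp_int_mul_two_pi_mul_I _
  rw [h4, mul_one]

/-! ### The lattice `K = I^⊥/I` and the `Θ`-product -/

/-- `I` is a primitive isotropic sublattice of `L` of rank `p`, where `(p, q)` is the signature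
of `L`. -/
structure IsMaximalIsotropic (I : Submodule ℤ V) : Prop where
  le : I ≤ L.lat
  isotropic : ∀ x ∈ I, ∀ y ∈ I, L.form x y = 0
  primitive : ∀ x ∈ L.lat, ∀ m : ℤ, m ≠ 0 → m • x ∈ I → x ∈ I
  rank : Module.finrank ℤ I = L.sigPos

variable (I : Submodule ℤ V)

/-- `I_ℚ`. -/
abbrev IQ : Submodule ℚ V := Submodule.span ℚ (I : Set V)

/-- `I_ℚ^⊥`. -/
abbrev perp : Submodule ℚ V := L.form.orthogonal (IQ I)

/-- `I^* = I_ℚ ∩ L^∨`. -/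
def Istar : Submodule ℤ V := (IQ I).restrictScalars ℤ ⊓ L.form.dualSubmodule L.lat

/-- The overlattice `L^* = ⟨L, I^*⟩` of `L`. -/
def Lstar : Submodule ℤ V := L.lat ⊔ L.Istar I

/-- `K_ℚ = I_ℚ^⊥ / I_ℚ`. -/
abbrev KQ : Type _ := ↥(L.perp I) ⧸ (IQ I).submoduleOf (L.perp I)

/-- The bilinear form on `K_ℚ` induced by that of `L`. -/
def formK : LinearMap.BilinForm ℚ (L.KQ I) :=
  LinearMap.liftQ₂ _ _ (L.form.restrict (L.perp I))
    (fun x hx => LinearMap.ext fun y => y.2 x.1 hx)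
    (fun x hx => LinearMap.ext fun y => by
      have h : L.form x.1 y.1 = 0 := y.2 x.1 hx
      rw [L.symm.eq] at h
      exact h)

/-- The lattice `K = (I^⊥ ∩ L)/I`. -/
def K : Submodule ℤ (L.KQ I) :=
  (L.lat.comap ((L.perp I).subtype.restrictScalars ℤ)).map
    ((Submodule.mkQ ((IQ I).submoduleOf (L.perp I))).restrictScalars ℤ)

lemma mk_mem_dual_K (y : L.perp I) (hy : (y : V) ∈ L.form.dualSubmodule (L.Lstar I)) :
    (Submodule.Quotient.mk y : L.KQ I) ∈ (L.formK I).dualSubmodule (L.K I) := by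
  rintro _ ⟨x, hx, rfl⟩
  exact hy x ((le_sup_left : L.lat ≤ L.Lstar I) hx)

open Classical in
/-- The canonical isometry `A_{L^*} → A_K`. Given a splitting `L^* = φ(pU) ⊕ φ(pU)^⊥` with
`φ(I_p) = I^*`, every class of `A_{L^*}` has a representative in the dual lattice of
`φ(pU)^⊥ ⊆ I_ℚ^⊥`, and `φ(pU)^⊥ ≅ K` is the reduction modulo `I_ℚ`. So the isometry takes the
class of a `y ∈ (L^*)^∨ ∩ I_ℚ^⊥` to the class of `y mod I_ℚ` (which does not depend on the
choice of `y` or of the splitting). -/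
def discIso (a : Disc L.form (L.Lstar I)) : Disc (L.formK I) (L.K I) :=
  if h : ∃ (y : L.perp I) (hy : (y : V) ∈ L.form.dualSubmodule (L.Lstar I)),
      cls L.form (L.Lstar I) y hy = a then
    cls (L.formK I) (L.K I) (Submodule.Quotient.mk h.choose)
      (L.mk_mem_dual_K I h.choose h.choose_spec.choose)
  else 0

/-- The pushforward `↓^L_K : ℂA_L → ℂA_{L^*} = ℂA_K`. -/
def pushK : (L.A →₀ ℂ) →ₗ[ℂ] (Disc (L.formK I) (L.K I) →₀ ℂ) :=
  Finsupp.lmapDomain ℂ ℂ (L.discIso I) ∘ₗ pushforward L.form L.lat (L.Lstar I)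

/-- The contraction `⟨v, Θ_{K⁺}(τ)⟩` for `v ∈ ℂA_K`, where `K⁺ = K(-1)` and
`Θ_{K⁺}(τ) ∈ ℂA_{K⁺} = (ℂA_K)^∨`. -/
def contractTheta (τ : ℍ) : (Disc (L.formK I) (L.K I) →₀ ℂ) →ₗ[ℂ] ℂ :=
  Finsupp.linearCombination ℂ fun a =>
    theta (-L.formK I) (L.K I) τ (discNeg (L.formK I) (L.K I) a)

/-- `ξ(f) = ⟨f↓^L_K, Θ_{K⁺}⟩`. -/
def xi (f : ℍ → (L.A →₀ ℂ)) (τ : ℍ) : ℂ := L.contractTheta I τ (L.pushK I (f τ))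

/-- The `Θ`-product `f₁ ∗ f₂ = ⟨f₁↓^L_K, Θ_{K⁺}⟩ · f₂` with respect to `I`. -/
def thetaMul (f₁ f₂ : ℍ → (L.A →₀ ℂ)) : ℍ → (L.A →₀ ℂ) := fun τ => L.xi I f₁ τ • f₂ τ

/-- All functions `ℍ → ℂA_L`, as a type to carry the `Θ`-product. -/
def ThetaAlgebra (_L : EvenLattice V) (_I : Submodule ℤ V) : Type _ := ℍ → (_L.A →₀ ℂ)

instance : AddCommGroup (L.ThetaAlgebra I) :=
  inferInstanceAs (AddCommGroup (ℍ → (L.A →₀ ℂ)))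

/-- Pointwise addition and the `Θ`-product. -/
instance : NonUnitalRing (L.ThetaAlgebra I) where
  mul := L.thetaMul I
  left_distrib f g h := funext fun τ => smul_add (L.xi I f τ) (g τ) (h τ)
  right_distrib f g h := funext fun τ => by
    change L.contractTheta I τ (L.pushK I (f τ + g τ)) • h τ =
      L.contractTheta I τ (L.pushK I (f τ)) • h τ + L.contractTheta I τ (L.pushK I (g τ)) • h τ
    rw [map_add, map_add, add_smul]
  zero_mul f := funext fun τ => by
    change L.contractTheta I τ (L.pushK I 0) • f τ = 0
    rw [map_zero, map_zero, zero_smul]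
  mul_zero f := funext fun τ => smul_zero (L.xi I f τ)
  mul_assoc f g h := funext fun τ => by
    change L.contractTheta I τ (L.pushK I (L.xi I f τ • g τ)) • h τ =
      L.xi I f τ • L.xi I g τ • h τ
    rw [map_smul, map_smul, smul_smul]
    rfl

end EvenLattice

end

end ThetaProduct

open ThetaProduct

/-! Write θ_a = ⟨e_a↓, Θ_{K⁺}⟩ for a in A_L, so that ξ(f) = ⟨f↓, Θ_{K⁺}⟩ = ∑_a f_a θ_a.
Associativity and distributivity only use that ξ is linear over scalar functions of τ, so the
content is that f₁ ∗ f₂ = ξ(f₁) f₂ is again modular, meromorphic at the cusp and, for integral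
inputs, integral. For this ξ(f₁) should be a holomorphic function, invariant under SL₂(ℤ), whose
q-expansion has integral exponents, finitely many negative ones, and coefficients in the ring
generated by those of f₁.

Invariance: I has the maximal rank p, so K is negative definite of rank n = q - p = -σ(L)
(`form_neg_of_mem_perp`, `sigma_eq`). The vector (θ_a) then transforms with weight n/2 under the
dual of ρ_L, which cancels the weight σ/2 and type ρ_L of f. It suffices to check the generators T
and S. For T, the exponents of θ_a lie in -q_L(a) + ℤ, because L^* is even
(`Represents.exists_expo_eq`). For S, Poisson summation for Gaussians (`exists_gaussian_poisson`)
gives theta inversion for K⁺ (`exists_theta_inversion`), and finite Fourier analysis on A_L carries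
it over to the θ_a (`sum_char_represents`, `sum_char_represents_eq_zero`).

No covolume is computed. The inversion is proved with an unknown constant c > 0; at the fixed point
i of S, the values θ_a(i) form an eigenvector of the Fourier matrix of A_L, whence c² = |A_L|
(`sum_thetaComponent_S`).

Integrality: the coefficients of θ_a count lattice vectors (`hasQExp_of_hasSum`), and Cauchy
products keep coefficients in a given subring of ℂ (`HasQExp.mul`). The subring ℂ gives closure of
M^!(L), and ℤ gives closure of the integral forms. -/

namespace ThetaProduct

noncomputable section

open MeasureTheory Module

/-! ### Poisson summation for ℤ^ι in ℝ^ι. -/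

section TorusPoisson

variable {ι : Type*}

/-- The projection `ℝ^ι → ℝ^ι/ℤ^ι`. -/
def torusMk (x : ι → ℝ) : UnitAddTorus ι := fun i => (x i : UnitAddCircle)

/-- The integral vector `m` as a real vector. -/
def intVec (m : ι → ℤ) : ι → ℝ := fun i => m i

lemma intVec_add (m n : ι → ℤ) : intVec (m + n) = intVec m + intVec n := by
  ext i; simp [intVec]

lemma isOpenQuotientMap_torusMk : IsOpenQuotientMap (torusMk : (ι → ℝ) → UnitAddTorus ι) :=
  IsOpenQuotientMap.piMap fun _ => QuotientAddGroup.isOpenQuotientMap_mk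

lemma exists_intVec_of_torusMk_eq {x y : ι → ℝ} (h : torusMk x = torusMk y) :
    ∃ m : ι → ℤ, y = x + intVec m := by
  have h' : ∀ i, ∃ m : ℤ, y i = x i + m := fun i => by
    have h1 : ((y i - x i : ℝ) : UnitAddCircle) = 0 := by
      rw [AddCircle.coe_sub, sub_eq_zero]
      exact (congrFun h i).symm
    obtain ⟨m, hm⟩ := (AddCircle.coe_eq_zero_iff _).1 h1
    exact ⟨m, by simp at hm; linarith⟩
  choose m hm using h'
  exact ⟨m, funext hm⟩

lemma torusMk_add_intVec (x : ι → ℝ) (m : ι → ℤ) : torusMk (x + intVec m) = torusMk x := by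
  funext i
  simp [torusMk, intVec]

/-- `∑_{m ∈ ℤ^ι} G(x + m)`. -/
def periodization (G : (ι → ℝ) → ℂ) (x : ι → ℝ) : ℂ := ∑' m : ι → ℤ, G (x + intVec m)

lemma periodization_add_intVec (G : (ι → ℝ) → ℂ) (x : ι → ℝ) (n : ι → ℤ) :
    periodization G (x + intVec n) = periodization G x := by
  unfold periodization
  rw [← (Equiv.addLeft n).tsum_eq (fun m => G (x + intVec m))]
  exact tsum_congr fun m => by simp [intVec_add, add_assoc]

variable [Fintype ι]

lemma mFourier_torusMk (n : ι → ℤ) (x : ι → ℝ) :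
    UnitAddTorus.mFourier n (torusMk x) =
      Complex.exp (2 * Real.pi * Complex.I * (∑ i, (n i : ℝ) * x i : ℝ)) := by
  simp only [UnitAddTorus.mFourier, torusMk, ContinuousMap.coe_mk, fourier_coe_apply]
  rw [← Complex.exp_sum]
  congr 1
  push_cast
  rw [Finset.mul_sum]
  exact Finset.sum_congr rfl fun i _ => by simp; ring

/-- The integer points of `ℝ^ι`. -/
def intVecEquiv : (ι → ℤ) ≃ Submodule.span ℤ (Set.range (Pi.basisFun ℝ ι)) :=
  ((Pi.basisFun ℝ ι).restrictScalars ℤ).equivFun.symm.toEquiv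

lemma coe_intVecEquiv (m : ι → ℤ) : ((intVecEquiv m : _) : ι → ℝ) = intVec m := by
  classical
  have : intVecEquiv m = ∑ i, m i • (Pi.basisFun ℝ ι).restrictScalars ℤ i :=
    Basis.equivFun_symm_apply _ _
  rw [this]
  ext j
  simp [intVec, Pi.single_apply]

/-- The unit cube is a fundamental domain for ℤ^ι. The half-open form (0, 1] is the one in which
Fourier coefficients on the torus are expressed. -/
lemma integral_eq_tsum_unitCube (f : (ι → ℝ) → ℂ) (hf : Integrable f) :
    ∫ x, f x = ∑' m : ι → ℤ, ∫ x in Set.univ.pi fun _ : ι => Set.Ioc (0 : ℝ) 1,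
      f (x + intVec m) := by
  have : Countable (Submodule.span ℤ (Set.range (Pi.basisFun ℝ ι))).toAddSubgroup :=
    intVecEquiv.symm.injective.countable
  have h := (ZSpan.isAddFundamentalDomain' (Pi.basisFun ℝ ι) volume).integral_eq_tsum'' f hf
  rw [h]
  change ∑' g : Submodule.span ℤ (Set.range (Pi.basisFun ℝ ι)),
    ∫ x in ZSpan.fundamentalDomain (Pi.basisFun ℝ ι), f ((g : ι → ℝ) + x) = _
  rw [← intVecEquiv.tsum_eq]
  refine tsum_congr fun m => ?_
  rw [ZSpan.fundamentalDomain_pi_basisFun]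
  -- The fundamental domain of the span is [0, 1)^ι, which differs from (0, 1]^ι by a null set.
  have h1 : (Set.univ.pi fun _ : ι => Set.Ioc (0 : ℝ) 1) =ᵐ[volume]
      (Set.univ.pi fun _ : ι => Set.Ico (0 : ℝ) 1) :=
    Measure.univ_pi_Ioc_ae_eq_Icc.trans Measure.univ_pi_Ico_ae_eq_Icc.symm
  rw [setIntegral_congr_set h1]
  congr 1
  funext x
  rw [coe_intVecEquiv, add_comm]

/-- `G` is bounded by a summable series on the integral translates of every ball. -/
def LocallySummable (G : (ι → ℝ) → ℂ) : Prop :=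
  ∀ R : ℝ, ∃ u : (ι → ℤ) → ℝ, Summable u ∧ ∀ x, ‖x‖ ≤ R → ∀ m, ‖G (x + intVec m)‖ ≤ u m

/-- Weierstrass M-test on a closed ball around each point. -/
lemma continuous_periodization {G : (ι → ℝ) → ℂ} (hG : Continuous G) (hs : LocallySummable G) :
    Continuous (periodization G) := by
  rw [continuous_iff_continuousAt]
  intro x
  obtain ⟨u, hu, hb⟩ := hs (‖x‖ + 1)
  have h : ContinuousOn (periodization G) (Metric.closedBall 0 (‖x‖ + 1)) :=
    continuousOn_tsum (fun m => (hG.comp (continuous_id.add continuous_const)).continuousOn) hu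
      fun m y hy => hb y (by simpa using hy) m
  exact h.continuousAt (Metric.closedBall_mem_nhds_of_mem (by simp))

/-- The function on the torus induced by the periodization. -/
def torusPeriodization (G : (ι → ℝ) → ℂ) (hG : Continuous G) (hs : LocallySummable G) :
    C(UnitAddTorus ι, ℂ) where
  toFun t := periodization G (Function.surjInv isOpenQuotientMap_torusMk.surjective t)
  continuous_toFun := by
    rw [isOpenQuotientMap_torusMk.isQuotientMap.continuous_iff]
    convert continuous_periodization hG hs using 1
    funext x
    obtain ⟨m, hm⟩ := exists_intVec_of_torusMk_eq
      (Function.surjInv_eq isOpenQuotientMap_torusMk.surjective (torusMk x))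
    conv_rhs => rw [hm, periodization_add_intVec]
    rfl

lemma torusPeriodization_torusMk (G : (ι → ℝ) → ℂ) (hG : Continuous G) (hs : LocallySummable G)
    (x : ι → ℝ) : torusPeriodization G hG hs (torusMk x) = periodization G x := by
  obtain ⟨m, hm⟩ := exists_intVec_of_torusMk_eq
    (Function.surjInv_eq isOpenQuotientMap_torusMk.surjective (torusMk x))
  conv_rhs => rw [hm, periodization_add_intVec]
  rfl

/-- Unfolding: the characters are invariant under ℤ^ι, so the sum over translates turns the integral
over the cube into one over ℝ^ι. -/
lemma mFourierCoeff_torusPeriodization (G : (ι → ℝ) → ℂ) (hG : Continuous G)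
    (hs : LocallySummable G) (hi : Integrable G) (n : ι → ℤ) :
    UnitAddTorus.mFourierCoeff (torusPeriodization G hG hs) n =
      ∫ x, UnitAddTorus.mFourier (-n) (torusMk x) * G x := by
  have hE : Continuous fun x : ι → ℝ => UnitAddTorus.mFourier (-n) (torusMk x) :=
    (map_continuous _).comp isOpenQuotientMap_torusMk.continuous
  have hE1 : ∀ x : ι → ℝ, ‖UnitAddTorus.mFourier (-n) (torusMk x)‖ = 1 := fun x => by
    rw [mFourier_torusMk, mul_comm, ← mul_assoc, mul_comm]
    rw [Complex.norm_exp]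
    simp
  have hEi : Integrable fun x : ι → ℝ => UnitAddTorus.mFourier (-n) (torusMk x) * G x := by
    refine hi.mono (hE.mul hG).aestronglyMeasurable (Filter.Eventually.of_forall fun x => ?_)
    rw [norm_mul, hE1, one_mul]
  rw [UnitAddTorus.mFourierCoeff_eq_integral _ _ 0, integral_eq_tsum_unitCube _ hEi]
  have hset : {x : ι → ℝ | ∀ i, x i ∈ Set.Ioc ((0 : ι → ℝ) i) ((0 : ι → ℝ) i + 1)} =
      Set.univ.pi fun _ : ι => Set.Ioc (0 : ℝ) 1 := by
    ext x; simp
  rw [hset]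
  obtain ⟨u, hu, hb⟩ := hs 1
  have hfin : volume (Set.univ.pi fun _ : ι => Set.Ioc (0 : ℝ) 1) ≠ ⊤ := by
    rw [volume_pi_pi]; simp
  have hmeas : MeasurableSet (Set.univ.pi fun _ : ι => Set.Ioc (0 : ℝ) 1) :=
    MeasurableSet.univ_pi fun _ => measurableSet_Ioc
  have hcont : ∀ m : ι → ℤ, Continuous fun x : ι → ℝ =>
      UnitAddTorus.mFourier (-n) (torusMk x) * G (x + intVec m) := fun m =>
    hE.mul (hG.comp (continuous_id.add continuous_const))
  have hbound : ∀ m : ι → ℤ, ∀ x ∈ (Set.univ.pi fun _ : ι => Set.Ioc (0 : ℝ) 1),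
      ‖UnitAddTorus.mFourier (-n) (torusMk x) * G (x + intVec m)‖ ≤ u m := fun m x hx => by
    rw [norm_mul, hE1, one_mul]
    refine hb x ((pi_norm_le_iff_of_nonneg zero_le_one).2 fun i => ?_) m
    have := hx i trivial
    rw [Real.norm_eq_abs, abs_le]
    exact ⟨by linarith [this.1], this.2⟩
  have hint : ∀ m : ι → ℤ, IntegrableOn (fun x : ι → ℝ =>
      UnitAddTorus.mFourier (-n) (torusMk x) * G (x + intVec m))
        (Set.univ.pi fun _ : ι => Set.Ioc (0 : ℝ) 1) := fun m =>
    Measure.integrableOn_of_bounded hfin (hcont m).aestronglyMeasurable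
      ((ae_restrict_iff' hmeas).2 (Filter.Eventually.of_forall (hbound m)))
  -- Sum and integral may be interchanged: on the cube, of finite volume, the terms are dominated by
  -- the summable `u`.
  have hkey := integral_tsum_of_summable_integral_norm hint (by
    refine Summable.of_nonneg_of_le (fun m => by positivity) (fun m => ?_)
      (hu.mul_right (volume.real (Set.univ.pi fun _ : ι => Set.Ioc (0 : ℝ) 1)))
    have := norm_setIntegral_le_of_norm_le_const (f := fun x => ‖UnitAddTorus.mFourier (-n)
      (torusMk x) * G (x + intVec m)‖) (C := u m) hfin.lt_top
      (fun x hx => by simpa using hbound m x hx)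
    exact (le_abs_self _).trans this)
  simp_rw [torusMk_add_intVec]
  rw [hkey]
  refine integral_congr_ae (Filter.Eventually.of_forall fun x => ?_)
  change _ • torusPeriodization G hG hs (torusMk x) = _
  rw [torusPeriodization_torusMk, smul_eq_mul]
  exact tsum_mul_left.symm

/-- Poisson summation for `ℤ^ι ⊆ ℝ^ι`. -/
theorem periodization_eq_tsum (G : (ι → ℝ) → ℂ) (hG : Continuous G)
    (hs : LocallySummable G) (hi : Integrable G)
    (hsum : Summable fun n : ι → ℤ => ∫ x, UnitAddTorus.mFourier (-n) (torusMk x) * G x)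
    (x : ι → ℝ) :
    HasSum (fun n : ι → ℤ => (∫ y, UnitAddTorus.mFourier (-n) (torusMk y) * G y) *
      UnitAddTorus.mFourier n (torusMk x)) (periodization G x) := by
  rw [← torusPeriodization_torusMk G hG hs]
  simp_rw [← mFourierCoeff_torusPeriodization G hG hs hi] at hsum ⊢
  exact UnitAddTorus.hasSum_mFourier_series_apply_of_summable hsum (torusMk x)

end TorusPoisson
end
end ThetaProduct

namespace ThetaProduct

noncomputable section

open MeasureTheory Module

set_option linter.unusedSectionVars false

/-! ### Poisson summation for Gaussians on a euclidean lattice. -/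

section GaussianPoisson

variable {ι : Type*} [Fintype ι] {E : Type*} [NormedAddCommGroup E] [InnerProductSpace ℝ E]
  [FiniteDimensional ℝ E] (v : Basis ι ℝ E)

/-- The lattice vector with integral coordinates `m`. -/
def latVec (m : ι → ℤ) : E := v.equivFun.symm (intVec m)

lemma latVec_eq (m : ι → ℤ) : latVec v m = ∑ i, (m i : ℝ) • v i := by
  simp [latVec, intVec, Basis.equivFun_symm_apply]

/-- Comparison with ∑ ‖x‖^{-2k}, which converges because 2k exceeds the rank. The inequality t^k /
k! ≤ exp t at t = a‖x‖² gives the majorant. -/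
lemma summable_exp_neg_norm_sq_latVec {a : ℝ} (ha : 0 < a) :
    Summable fun m : ι → ℤ => Real.exp (-a * ‖latVec v m‖ ^ 2) := by
  set k := finrank ℝ E + 1 with hk
  let L := Submodule.span ℤ (Set.range v)
  have hL : IsZLattice ℝ L := inferInstance
  have h1 : Summable fun z : L => ‖z‖⁻¹ ^ (2 * k) :=
    ZLattice.summable_norm_pow_inv L (2 * k) (by rw [ZLattice.rank ℝ L]; omega)
  let φ : (ι → ℤ) ≃ L := (v.restrictScalars ℤ).equivFun.symm.toEquiv
  have hφ : ∀ m, ((φ m : L) : E) = latVec v m := fun m => by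
    have : φ m = ∑ i, m i • v.restrictScalars ℤ i := Basis.equivFun_symm_apply _ _
    rw [this, latVec_eq]
    simp [Int.cast_smul_eq_zsmul]
  have h2 : Summable fun m : ι → ℤ => (k.factorial / a ^ k) * ‖latVec v m‖⁻¹ ^ (2 * k) := by
    refine Summable.mul_left _ ?_
    refine (φ.summable_iff.2 h1).congr fun m => ?_
    simp only [Function.comp_apply, ← hφ]
    rfl
  refine Summable.of_norm_bounded_eventually h2 ?_
  -- The bound fails only at m = 0, where the inverse norm is `0` by convention.
  refine (Set.finite_singleton (0 : ι → ℤ)).subset fun m hm => ?_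
  by_contra hm0
  refine hm ?_
  have hne : latVec v m ≠ 0 := fun h => hm0 (by
    have h0 : intVec m = 0 := v.equivFun.symm.map_eq_zero_iff.1 h
    funext i
    have := congrFun h0 i
    simpa [intVec] using this)
  have hpos : 0 < ‖latVec v m‖ := norm_pos_iff.2 hne
  have h3 := Real.pow_div_factorial_le_exp (a * ‖latVec v m‖ ^ 2) (by positivity) k
  change ‖Real.exp (-a * ‖latVec v m‖ ^ 2)‖ ≤ k.factorial / a ^ k * ‖latVec v m‖⁻¹ ^ (2 * k)
  rw [Real.norm_of_nonneg (Real.exp_pos _).le, neg_mul, Real.exp_neg]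
  rw [inv_le_comm₀ (Real.exp_pos _) (by positivity)]
  refine le_of_eq_of_le ?_ h3
  rw [inv_pow, pow_mul, mul_pow]
  field_simp

/-- From (s + t)² ≤ 2s² + 2t². It bounds a shifted Gaussian, uniformly for w in a ball, by an
unshifted one of half the rate. -/
lemma norm_sq_add_ge (w y : E) : ‖y‖ ^ 2 / 2 - ‖w‖ ^ 2 ≤ ‖w + y‖ ^ 2 := by
  have h : ‖y‖ ≤ ‖w + y‖ + ‖w‖ := by
    have := norm_sub_le (w + y) w
    simpa using this
  nlinarith [norm_nonneg y, norm_nonneg w, norm_nonneg (w + y), sq_nonneg (‖w + y‖ - ‖w‖)]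

lemma exp_neg_norm_sq_add_latVec_le {a R : ℝ} (ha : 0 < a) {w : E} (hw : ‖w‖ ≤ R)
    (m : ι → ℤ) : Real.exp (-a * ‖w + latVec v m‖ ^ 2) ≤
      Real.exp (a * R ^ 2) * Real.exp (-(a / 2) * ‖latVec v m‖ ^ 2) := by
  rw [← Real.exp_add, Real.exp_le_exp]
  have h1 := norm_sq_add_ge w (latVec v m)
  have h2 : ‖w‖ ^ 2 ≤ R ^ 2 := by gcongr
  nlinarith

lemma summable_exp_neg_norm_sq_add_latVec {a : ℝ} (ha : 0 < a) (w : E) :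
    Summable fun m : ι → ℤ => Real.exp (-a * ‖w + latVec v m‖ ^ 2) :=
  Summable.of_nonneg_of_le (fun _ => (Real.exp_pos _).le)
    (fun m => exp_neg_norm_sq_add_latVec_le v ha le_rfl m)
    ((summable_exp_neg_norm_sq_latVec v (half_pos ha)).mul_left _)

lemma norm_cexp_neg_mul_norm_sq (b : ℂ) (y : E) :
    ‖Complex.exp (-b * (‖y‖ : ℂ) ^ 2)‖ = Real.exp (-b.re * ‖y‖ ^ 2) := by
  rw [Complex.norm_exp]
  congr 1
  rw [← Complex.ofReal_pow, Complex.re_mul_ofReal, Complex.neg_re]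

lemma locallySummable_gaussian {b : ℂ} (hb : 0 < b.re) :
    LocallySummable fun x : ι → ℝ =>
      Complex.exp (-b * (‖v.equivFun.symm x‖ : ℂ) ^ 2) := by
  intro R
  obtain ⟨C, hC⟩ : ∃ C : ℝ, ∀ x : ι → ℝ, ‖v.equivFun.symm x‖ ≤ C * ‖x‖ := by
    let T := LinearMap.toContinuousLinearMap (v.equivFun.symm : (ι → ℝ) →ₗ[ℝ] E)
    exact ⟨‖T‖, T.le_opNorm⟩
  refine ⟨_, (summable_exp_neg_norm_sq_latVec v (half_pos hb)).mul_left
    (Real.exp (b.re * (|C| * |R|) ^ 2)), fun x hx m => ?_⟩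
  rw [norm_cexp_neg_mul_norm_sq, map_add]
  refine exp_neg_norm_sq_add_latVec_le v hb ?_ m
  calc ‖v.equivFun.symm x‖ ≤ C * ‖x‖ := hC x
    _ ≤ |C| * |R| := mul_le_mul (le_abs_self C) (hx.trans (le_abs_self R)) (norm_nonneg _)
        (abs_nonneg _)

variable [MeasurableSpace E] [BorelSpace E]

/-- Uniqueness of Haar measure. The constant is the inverse covolume of the lattice, but only its
positivity is kept. -/
lemma exists_integral_comp_equivFun_symm :
    ∃ c : ℝ, 0 < c ∧ (∀ f : E → ℂ, ∫ x, f (v.equivFun.symm x) = c * ∫ y, f y) ∧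
      ∀ f : E → ℂ, Integrable f → Integrable fun x => f (v.equivFun.symm x) := by
  let T : (ι → ℝ) ≃L[ℝ] E := v.equivFun.symm.toContinuousLinearEquiv
  have hT : MeasurableEmbedding T := T.toHomeomorph.measurableEmbedding
  have : (Measure.map T (volume : Measure (ι → ℝ))).IsAddHaarMeasure :=
    T.isAddHaarMeasure_map volume
  have h := Measure.isAddLeftInvariant_eq_smul (Measure.map T (volume : Measure (ι → ℝ)))
    (volume : Measure E)
  set c := (Measure.map T (volume : Measure (ι → ℝ))).addHaarScalarFactor (volume : Measure E)
  have hc : c ≠ 0 := by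
    intro h0
    rw [h0, zero_smul] at h
    exact NeZero.ne (Measure.map T (volume : Measure (ι → ℝ))) h
  refine ⟨c, by positivity, fun f => ?_, fun f hf => ?_⟩
  · have h1 := hT.integral_map (μ := volume) f
    rw [h, integral_smul_nnreal_measure] at h1
    exact h1.symm.trans (by simp [NNReal.smul_def])
  · have h1 : Integrable f (Measure.map T volume) := by
      rw [h]; exact hf.smul_measure_nnreal
    exact (hT.integrable_map_iff).1 h1

/-- Poisson summation for Gaussians and the lattice spanned by a basis `v`; here `d` maps the
integral vectors to the dual lattice. -/
theorem exists_gaussian_poisson (d : (ι → ℤ) → E) (dv : Basis ι ℝ E)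
    (hd : ∀ n, d n = latVec dv n) (hdv : ∀ n i, inner ℝ (d n) (v i) = (n i : ℝ)) :
    ∃ c : ℝ, 0 < c ∧ ∀ (b : ℂ), 0 < b.re → ∀ w : E,
      ∑' m : ι → ℤ, Complex.exp (-b * (‖w + latVec v m‖ : ℂ) ^ 2) =
        c * (Real.pi / b) ^ (finrank ℝ E / 2 : ℂ) * ∑' n : ι → ℤ,
          Complex.exp (-Real.pi ^ 2 * (‖d n‖ : ℂ) ^ 2 / b +
            2 * Real.pi * Complex.I * (inner ℝ w (d n) : ℝ)) := by
  obtain ⟨c, hc, hint, hinteg⟩ := exists_integral_comp_equivFun_symm v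
  refine ⟨c, hc, fun b hb w => ?_⟩
  set G : (ι → ℝ) → ℂ := fun x => Complex.exp (-b * (‖v.equivFun.symm x‖ : ℂ) ^ 2) with hG
  have hGc : Continuous G := by
    have : Continuous (v.equivFun.symm : (ι → ℝ) → E) :=
      LinearMap.continuous_of_finiteDimensional (v.equivFun.symm : (ι → ℝ) →ₗ[ℝ] E)
    fun_prop
  have hGi : Integrable G := by
    refine hinteg (fun y => Complex.exp (-b * (‖y‖ : ℂ) ^ 2)) ?_
    simpa using GaussianFourier.integrable_cexp_neg_mul_sq_norm_add hb 0 (0 : E)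
  have hinner : ∀ (n : ι → ℤ) (x : ι → ℝ),
      ∑ i, (n i : ℝ) * x i = inner ℝ (v.equivFun.symm x) (d n) := fun n x => by
    rw [Basis.equivFun_symm_apply, sum_inner]
    exact Finset.sum_congr rfl fun i _ => by
      rw [real_inner_smul_left, real_inner_comm, hdv, mul_comm]
  have hcoeff : ∀ n : ι → ℤ, ∫ x, UnitAddTorus.mFourier (-n) (torusMk x) * G x =
      c * ((Real.pi / b) ^ (finrank ℝ E / 2 : ℂ) *
        Complex.exp (-Real.pi ^ 2 * (‖d n‖ : ℂ) ^ 2 / b)) := fun n => by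
    rw [← fourier_gaussian_innerProductSpace hb, Real.fourier_eq', ← hint]
    congr 1
    funext x
    rw [mFourier_torusMk, smul_eq_mul, ← hinner]
    congr 2
    push_cast
    simp only [Pi.neg_apply, Int.cast_neg, neg_mul, Finset.sum_neg_distrib]
    ring
  -- The Fourier coefficients are Gaussians in `d n` with parameter π²/b; its positive real part
  -- makes the dual sum converge.
  have hb' : 0 < (Real.pi ^ 2 / b : ℂ).re := by
    rw [div_eq_mul_inv, ← Complex.ofReal_pow, Complex.re_ofReal_mul, Complex.inv_re]
    have : b ≠ 0 := fun h => by simp [h] at hb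
    have := Complex.normSq_pos.2 this
    positivity
  have hs : Summable fun n : ι → ℤ => ∫ x, UnitAddTorus.mFourier (-n) (torusMk x) * G x := by
    simp_rw [hcoeff]
    refine Summable.mul_left _ (Summable.mul_left _ (Summable.of_norm ?_))
    refine (summable_exp_neg_norm_sq_latVec dv hb').congr fun n => ?_
    rw [← norm_cexp_neg_mul_norm_sq, hd]
    congr 2
    ring
  have key := periodization_eq_tsum G hGc (locallySummable_gaussian v hb) hGi hs (v.equivFun w)
  have hper : periodization G (v.equivFun w) =
      ∑' m : ι → ℤ, Complex.exp (-b * (‖w + latVec v m‖ : ℂ) ^ 2) := by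
    refine tsum_congr fun m => ?_
    simp only [hG, map_add, LinearEquiv.symm_apply_apply]
    rfl
  rw [← hper, ← key.tsum_eq, ← tsum_mul_left]
  refine tsum_congr fun n => ?_
  rw [hcoeff, mFourier_torusMk, hinner, LinearEquiv.symm_apply_apply, Complex.exp_add]
  ring

end GaussianPoisson
end
end ThetaProduct

namespace ThetaProduct

noncomputable section

open MeasureTheory Module

set_option linter.unusedSectionVars false

/-! ### Positive definite rational lattices and theta inversion. -/

section PosDefLattice

variable {W : Type*} [AddCommGroup W] [Module ℚ W] [FiniteDimensional ℚ W]

lemma exists_basis_span_eq {N : Submodule ℤ W} (hfg : N.FG)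
    (hspan : Submodule.span ℚ (N : Set W) = ⊤) :
    ∃ b : Basis (Fin (finrank ℚ W)) ℚ W, N = Submodule.span ℤ (Set.range b) := by
  have hN : Submodule.IsLattice ℚ N := ⟨hfg, hspan⟩
  have hfree : Module.Free ℤ N := Submodule.IsLattice.free ℚ N
  have hfin : Module.Finite ℤ N := Submodule.IsLattice.finite ℚ N
  have hrank : finrank ℤ N = finrank ℚ W :=
    congrArg Cardinal.toNat (Submodule.IsLattice.rank' ℚ N)
  let b₀ : Basis (Fin (finrank ℚ W)) ℤ N := (Module.finBasisOfFinrankEq ℤ N hrank)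
  refine ⟨b₀.extendOfIsLattice ℚ, ?_⟩
  have h1 : Set.range (b₀.extendOfIsLattice ℚ) = N.subtype '' Set.range b₀ := by
    rw [← Set.range_comp]
    congr 1
    funext i
    simp
  rw [h1, ← Submodule.map_span, b₀.span_eq, Submodule.map_top, Submodule.range_subtype]

/-- Diagonalise over ℚ and rescale the coordinates by the square roots of the diagonal entries. -/
lemma exists_isometry_euclidean (B : LinearMap.BilinForm ℚ W) (hs : B.IsSymm)
    (hpos : ∀ x, x ≠ 0 → 0 < B x x) :
    ∃ φ : W →ₗ[ℚ] EuclideanSpace ℝ (Fin (finrank ℚ W)),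
      ∀ x y, inner ℝ (φ x) (φ y) = ((B x y : ℚ) : ℝ) := by
  have : Invertible (2 : ℚ) := invertibleOfNonzero two_ne_zero
  obtain ⟨v, hv⟩ := LinearMap.BilinForm.exists_orthogonal_basis (K := ℚ) (B := B)
    (LinearMap.BilinForm.isSymm_iff.1 hs)
  have hd : ∀ i, (0 : ℝ) ≤ (B (v i) (v i) : ℚ) := fun i => by
    exact_mod_cast (hpos _ (v.ne_zero i)).le
  refine ⟨{ toFun := fun x => WithLp.toLp 2 fun i =>
              ((v.repr x i : ℚ) : ℝ) * Real.sqrt (B (v i) (v i) : ℚ)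
            map_add' := fun x y => by ext i; simp [add_mul]
            map_smul' := fun r x => by
              ext i; simp [mul_assoc, Rat.smul_def] }, fun x y => ?_⟩
  have hB : B x y = ∑ i, v.repr x i * v.repr y i * B (v i) (v i) := by
    conv_lhs => rw [← v.sum_repr x, ← v.sum_repr y]
    simp only [map_sum, LinearMap.sum_apply, map_smul, LinearMap.smul_apply, smul_eq_mul]
    refine Finset.sum_congr rfl fun i _ => ?_
    rw [Finset.sum_eq_single i]
    · ring
    · intro j _ hj
      have : B (v j) (v i) = 0 := hv hj
      rw [this]; ring
    · simp
  rw [hB, PiLp.inner_apply]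
  push_cast
  refine Finset.sum_congr rfl fun i _ => ?_
  simp only [LinearMap.coe_mk, AddHom.coe_mk, RCLike.inner_apply, conj_trivial]
  have := Real.mul_self_sqrt (hd i)
  linear_combination ((v.repr x i : ℚ) : ℝ) * ((v.repr y i : ℚ) : ℝ) * this

lemma nondegenerate_of_posDef (B : LinearMap.BilinForm ℚ W) (hs : B.IsSymm)
    (hpos : ∀ x, x ≠ 0 → 0 < B x x) : B.Nondegenerate := by
  refine (LinearMap.IsRefl.nondegenerate_iff_separatingLeft hs.isRefl).2 fun x hx => ?_
  by_contra h
  exact (hpos x h).ne' (hx x)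

/-- The image of a rational basis under an isometry into a euclidean space is a real basis. -/
lemma exists_real_basis (B : LinearMap.BilinForm ℚ W) (hs : B.IsSymm) (hB : B.Nondegenerate)
    (φ : W →ₗ[ℚ] EuclideanSpace ℝ (Fin (finrank ℚ W)))
    (hφ : ∀ x y, inner ℝ (φ x) (φ y) = ((B x y : ℚ) : ℝ))
    (b : Basis (Fin (finrank ℚ W)) ℚ W) :
    ∃ v : Basis (Fin (finrank ℚ W)) ℝ (EuclideanSpace ℝ (Fin (finrank ℚ W))),
      ∀ i, v i = φ (b i) := by
  have hli : LinearIndependent ℝ fun i => φ (b i) := by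
    rw [Fintype.linearIndependent_iff]
    intro c hc j
    -- Independence over ℚ does not give independence over ℝ by itself. Pairing a real relation with
    -- the image of the dual basis isolates each coefficient.
    have h := congrArg (fun y => inner ℝ y (φ (B.dualBasis hB b j))) hc
    simp only [sum_inner, real_inner_smul_left, hφ, inner_zero_left] at h
    rw [Finset.sum_eq_single j] at h
    · rw [hs.eq, LinearMap.BilinForm.apply_dualBasis_left] at h
      simpa using h
    · intro i _ hij
      rw [hs.eq, LinearMap.BilinForm.apply_dualBasis_left, if_neg hij]
      simp
    · simp
  have hcard : Fintype.card (Fin (finrank ℚ W)) =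
      finrank ℝ (EuclideanSpace ℝ (Fin (finrank ℚ W))) := by simp
  exact ⟨basisOfTopLeSpanOfCardEqFinrank _ (hli.span_eq_top_of_card_eq_finrank' hcard).ge hcard,
    fun i => by simp⟩

/-- The vectors of the lattice with basis `b`, indexed by their coordinates. -/
def spanEquiv {ι : Type*} [Fintype ι] (b : Basis ι ℚ W) :
    (ι → ℤ) ≃ Submodule.span ℤ (Set.range b) :=
  (b.restrictScalars ℤ).equivFun.symm.toEquiv

lemma coe_spanEquiv {ι : Type*} [Fintype ι] (b : Basis ι ℚ W) (m : ι → ℤ) :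
    ((spanEquiv b m : _) : W) = ∑ i, (m i : ℚ) • b i := by
  have : spanEquiv b m = ∑ i, m i • b.restrictScalars ℤ i := Basis.equivFun_symm_apply _ _
  rw [this]
  simp [Int.cast_smul_eq_zsmul]

lemma map_spanEquiv {ι κ : Type*} [Fintype ι] [Fintype κ] (b : Basis ι ℚ W)
    (φ : W →ₗ[ℚ] EuclideanSpace ℝ κ) (v : Basis ι ℝ (EuclideanSpace ℝ κ)) (hv : ∀ i, v i = φ (b i)) (m : ι → ℤ) :
    φ (spanEquiv b m) = latVec v m := by
  rw [coe_spanEquiv, latVec_eq, map_sum]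
  refine Finset.sum_congr rfl fun i _ => ?_
  rw [map_smul, hv, Int.cast_smul_eq_zsmul, Int.cast_smul_eq_zsmul]

lemma norm_sq_eq_form {B : LinearMap.BilinForm ℚ W}
    {φ : W →ₗ[ℚ] EuclideanSpace ℝ (Fin (finrank ℚ W))}
    (hφ : ∀ x y, inner ℝ (φ x) (φ y) = ((B x y : ℚ) : ℝ)) (x : W) :
    ‖φ x‖ ^ 2 = ((B x x : ℚ) : ℝ) := by
  rw [← hφ, real_inner_self_eq_norm_sq]

lemma summable_exp_neg_form (B : LinearMap.BilinForm ℚ W) (hs : B.IsSymm)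
    (hpos : ∀ x, x ≠ 0 → 0 < B x x) {N : Submodule ℤ W} (hfg : N.FG)
    (hspan : Submodule.span ℚ (N : Set W) = ⊤) (w : W) {a : ℝ} (ha : 0 < a) :
    Summable fun k : N => Real.exp (-a * (B (w + k) (w + k) : ℚ)) := by
  obtain ⟨φ, hφ⟩ := exists_isometry_euclidean B hs hpos
  obtain ⟨b, rfl⟩ := exists_basis_span_eq hfg hspan
  obtain ⟨v, hv⟩ := exists_real_basis B hs (nondegenerate_of_posDef B hs hpos) φ hφ b
  refine (spanEquiv b).summable_iff.1 ?_
  refine (summable_exp_neg_norm_sq_add_latVec v ha (φ w)).congr fun m => ?_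
  rw [Function.comp_apply, ← norm_sq_eq_form hφ, map_add, map_spanEquiv b φ v hv]

/-- The theta inversion formula for a positive definite lattice. The constant is the square root
of the order of the discriminant group, but only its positivity matters here. -/
theorem exists_theta_inversion (B : LinearMap.BilinForm ℚ W) (hs : B.IsSymm)
    (hpos : ∀ x, x ≠ 0 → 0 < B x x) {N : Submodule ℤ W} (hfg : N.FG)
    (hspan : Submodule.span ℚ (N : Set W) = ⊤) :
    ∃ c : ℝ, 0 < c ∧ ∀ (τ : ℍ) (w : W),
      ∑' z : B.dualSubmodule N, e (((B z z / 2 : ℚ) : ℂ) * (-1 / (τ : ℂ))) * e (-((B w z : ℚ) : ℂ)) =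
        c * (-Complex.I * τ) ^ (finrank ℚ W / 2 : ℂ) *
          ∑' k : N, e (((B (w + k) (w + k) / 2 : ℚ) : ℂ) * (τ : ℂ)) := by
  have hB := nondegenerate_of_posDef B hs hpos
  obtain ⟨φ, hφ⟩ := exists_isometry_euclidean B hs hpos
  obtain ⟨b, rfl⟩ := exists_basis_span_eq hfg hspan
  obtain ⟨v, hv⟩ := exists_real_basis B hs hB φ hφ b
  obtain ⟨dv, hdv⟩ := exists_real_basis B hs hB φ hφ (B.dualBasis hB b)
  obtain ⟨c, hc, h⟩ := exists_gaussian_poisson v (latVec dv) dv (fun _ => rfl) (fun n i => by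
    rw [← map_spanEquiv _ φ dv hdv, hv, hφ, coe_spanEquiv, map_sum, LinearMap.sum_apply,
      Finset.sum_eq_single i]
    · rw [map_smul, LinearMap.smul_apply, LinearMap.BilinForm.apply_dualBasis_left]
      simp
    · intro j _ hj
      rw [map_smul, LinearMap.smul_apply, LinearMap.BilinForm.apply_dualBasis_left,
        if_neg hj.symm, smul_zero]
    · simp)
  -- The constant is inverted because Poisson summation expresses the lattice sum by the dual sum,
  -- and here it is solved for the dual sum.
  refine ⟨c⁻¹, inv_pos.2 hc, fun τ w => ?_⟩
  have hτ : (τ : ℂ) ≠ 0 := τ.ne_zero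
  have hπ : (Real.pi : ℂ) ≠ 0 := by exact_mod_cast Real.pi_ne_zero
  have hre : (-Complex.I * τ : ℂ).re = τ.im := by simp
  -- Poisson summation is used at b = -πiτ, for which exp(-b‖x‖²) = e((x, x)τ/2).
  have hb : 0 < (Real.pi * (-Complex.I * τ) : ℂ).re := by
    rw [Complex.re_ofReal_mul, hre]
    exact mul_pos Real.pi_pos τ.im_pos
  have h1 := h _ hb (φ w)
  have hdual := LinearMap.BilinForm.dualSubmodule_span_of_basis (R := ℤ) B hB b
  have hI : Complex.I ^ 2 = -1 := Complex.I_sq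
  have hL : ∑' k : Submodule.span ℤ (Set.range b),
      e (((B (w + k) (w + k) / 2 : ℚ) : ℂ) * (τ : ℂ)) = ∑' m : Fin (finrank ℚ W) → ℤ,
        Complex.exp (-(Real.pi * (-Complex.I * τ)) * (‖φ w + latVec v m‖ : ℂ) ^ 2) := by
    rw [← (spanEquiv b).tsum_eq]
    refine tsum_congr fun m => ?_
    rw [← map_spanEquiv b φ v hv, ← map_add, ← Complex.ofReal_pow, norm_sq_eq_form hφ, e]
    congr 1
    push_cast
    ring
  have hR : ∑' z : B.dualSubmodule (Submodule.span ℤ (Set.range b)),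
      e (((B z z / 2 : ℚ) : ℂ) * (-1 / (τ : ℂ))) * e (-((B w z : ℚ) : ℂ)) =
      ∑' n : Fin (finrank ℚ W) → ℤ, Complex.exp (-Real.pi ^ 2 * (‖latVec dv n‖ : ℂ) ^ 2 /
        (Real.pi * (-Complex.I * τ)) +
          2 * Real.pi * Complex.I * (inner ℝ (φ w) (latVec dv n) : ℝ)) := by
    -- The substitution z ↦ -z turns e(-(w, z)) into the character e((w, z)) of the Poisson formula.
    rw [hdual, ← (Equiv.neg _).tsum_eq, ← (spanEquiv (B.dualBasis hB b)).tsum_eq]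
    refine tsum_congr fun n => ?_
    rw [← map_spanEquiv _ φ dv hdv, ← Complex.ofReal_pow ‖_‖, norm_sq_eq_form hφ, hφ, e, e,
      ← Complex.exp_add]
    congr 1
    simp only [Equiv.neg_apply, NegMemClass.coe_neg, map_neg, LinearMap.neg_apply, neg_neg]
    push_cast
    field_simp
    linear_combination (-((B ((spanEquiv (B.dualBasis hB b)) n)
      ((spanEquiv (B.dualBasis hB b)) n) : ℚ) : ℂ)) * hI
  rw [hL, hR, h1]
  -- Here π/b = (-iτ)⁻¹. Since -iτ has positive real part, it avoids the branch cut, so the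
  -- principal powers are inverse to each other.
  have hpow : (-Complex.I * τ : ℂ) ^ (finrank ℚ W / 2 : ℂ) *
      (Real.pi / (Real.pi * (-Complex.I * τ)) : ℂ) ^ (finrank ℚ W / 2 : ℂ) = 1 := by
    have h2 : (Real.pi / (Real.pi * (-Complex.I * τ)) : ℂ) = (-Complex.I * τ)⁻¹ := by
      field_simp
    have h3 : (-Complex.I * τ : ℂ) ≠ 0 := fun h0 => by
      rw [h0] at hre; exact τ.im_pos.ne hre
    rw [h2, Complex.inv_cpow _ _ (fun harg => by
      have := Complex.arg_eq_pi_iff.1 harg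
      rw [hre] at this
      linarith [this.1, τ.im_pos])]
    exact mul_inv_cancel₀ (by rw [Complex.cpow_ne_zero_iff]; exact Or.inl h3)
  have hcc : (c : ℂ) ≠ 0 := by exact_mod_cast hc.ne'
  rw [finrank_euclideanSpace_fin, Complex.ofReal_inv]
  generalize (∑' n : Fin (finrank ℚ W) → ℤ, Complex.exp (-Real.pi ^ 2 *
    (‖latVec dv n‖ : ℂ) ^ 2 / (Real.pi * (-Complex.I * τ)) +
      2 * Real.pi * Complex.I * (inner ℝ (φ w) (latVec dv n) : ℝ))) = X
  rw [show (c : ℂ)⁻¹ * (-Complex.I * τ) ^ (finrank ℚ W / 2 : ℂ) * (c * (Real.pi /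
    (Real.pi * (-Complex.I * τ)) : ℂ) ^ (finrank ℚ W / 2 : ℂ) * X) = ((c : ℂ)⁻¹ * c) *
    ((-Complex.I * τ) ^ (finrank ℚ W / 2 : ℂ) * (Real.pi /
    (Real.pi * (-Complex.I * τ)) : ℂ) ^ (finrank ℚ W / 2 : ℂ)) * X by ring, hpow,
    inv_mul_cancel₀ hcc, one_mul, one_mul]

end PosDefLattice
end
end ThetaProduct

namespace ThetaProduct

noncomputable section

open Module

set_option linter.unusedSectionVars false

/-! ### The exponential e(x). -/

section Exponential

lemma e_add (x y : ℂ) : e (x + y) = e x * e y := by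
  rw [e, e, e, ← Complex.exp_add, mul_add]

lemma e_zero : e 0 = 1 := by simp [e]

lemma e_ne_zero (x : ℂ) : e x ≠ 0 := Complex.exp_ne_zero _

lemma e_intCast (m : ℤ) : e (m : ℂ) = 1 := by
  rw [e, mul_comm]
  exact Complex.exp_int_mul_two_pi_mul_I m

lemma e_ratCast_eq_one_iff {x : ℚ} : e (x : ℂ) = 1 ↔ ∃ m : ℤ, x = m := by
  constructor
  · intro h
    obtain ⟨m, hm⟩ := Complex.exp_eq_one_iff.1 h
    refine ⟨m, ?_⟩
    have h2 : (2 * (Real.pi : ℂ) * Complex.I) ≠ 0 := Complex.two_pi_I_ne_zero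
    rw [mul_comm] at hm
    exact_mod_cast mul_right_cancel₀ h2 hm
  · rintro ⟨m, rfl⟩
    exact_mod_cast e_intCast m

lemma e_ratCast_eq_of_sub {x y : ℚ} (m : ℤ) (h : x - y = m) : e (x : ℂ) = e (y : ℂ) := by
  have h1 : x = y + m := by linarith
  rw [h1, Rat.cast_add, e_add, Rat.cast_intCast, e_intCast, mul_one]

lemma norm_e (x : ℂ) : ‖e x‖ = Real.exp (-2 * Real.pi * x.im) := by
  rw [e, Complex.norm_exp]
  congr 1
  simp [Complex.mul_re, Complex.mul_im]

end Exponential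

/-! ### Dual lattices and characters of the discriminant group. -/

section Lattice

variable {V : Type*} [AddCommGroup V] [Module ℚ V]

lemma mem_dualSubmodule_iff {B : LinearMap.BilinForm ℚ V} {N : Submodule ℤ V} {x : V} :
    x ∈ B.dualSubmodule N ↔ ∀ y ∈ N, ∃ m : ℤ, B x y = m := by
  simp only [LinearMap.BilinForm.mem_dualSubmodule, Submodule.mem_one]
  exact ⟨fun h y hy => (h y hy).imp fun _ hm => hm.symm,
    fun h y hy => (h y hy).imp fun _ hm => hm.symm⟩

lemma exists_zsmul_mem {N : Submodule ℤ V} (hspan : Submodule.span ℚ (N : Set V) = ⊤) (y : V) :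
    ∃ k : ℤ, k ≠ 0 ∧ k • y ∈ N := by
  have hy : y ∈ Submodule.span ℚ (N : Set V) := hspan ▸ Submodule.mem_top
  induction hy using Submodule.span_induction with
  | mem x hx => exact ⟨1, one_ne_zero, by simpa using hx⟩
  | zero => exact ⟨1, one_ne_zero, by simp⟩
  | add x y _ _ hx hy =>
    obtain ⟨k, hk, hkx⟩ := hx
    obtain ⟨l, hl, hly⟩ := hy
    refine ⟨k * l, mul_ne_zero hk hl, ?_⟩
    rw [smul_add]
    refine N.add_mem ?_ ?_
    · rw [mul_comm, mul_smul]; exact N.smul_mem _ hkx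
    · rw [mul_smul]; exact N.smul_mem _ hly
  | smul q x _ hx =>
    obtain ⟨k, hk, hkx⟩ := hx
    refine ⟨k * q.den, mul_ne_zero hk (by exact_mod_cast q.den_nz), ?_⟩
    have h : (k * (q.den : ℤ)) • q • x = q.num • k • x := by
      rw [← Int.cast_smul_eq_zsmul ℚ, ← Int.cast_smul_eq_zsmul ℚ q.num,
        ← Int.cast_smul_eq_zsmul ℚ k, smul_smul, smul_smul]
      congr 1
      push_cast
      rw [mul_assoc, Rat.den_mul_eq_num, mul_comm]
    rw [h]
    exact N.smul_mem _ hkx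

lemma span_eq_top_of_le {N N' : Submodule ℤ V} (h : N ≤ N')
    (hspan : Submodule.span ℚ (N : Set V) = ⊤) : Submodule.span ℚ (N' : Set V) = ⊤ :=
  top_le_iff.1 (hspan ▸ Submodule.span_mono h)

section Disc

variable {B : LinearMap.BilinForm ℚ V} {N : Submodule ℤ V}

lemma rep_mem (a : Disc B N) : rep a ∈ B.dualSubmodule N := (Quotient.out a).2

lemma cls_rep (a : Disc B N) : cls B N (rep a) (rep_mem a) = a := Quotient.out_eq a

lemma cls_eq_cls_iff {x y : V} (hx : x ∈ B.dualSubmodule N) (hy : y ∈ B.dualSubmodule N) :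
    cls B N x hx = cls B N y hy ↔ x - y ∈ N :=
  Submodule.Quotient.eq (N.submoduleOf (B.dualSubmodule N))

lemma cls_eq_iff {x : V} (hx : x ∈ B.dualSubmodule N) (a : Disc B N) :
    cls B N x hx = a ↔ x - rep a ∈ N := by
  conv_lhs => rw [← cls_rep a]
  exact cls_eq_cls_iff _ _

lemma rep_cls_sub_mem {x : V} (hx : x ∈ B.dualSubmodule N) : rep (cls B N x hx) - x ∈ N := by
  rw [← cls_eq_cls_iff (rep_mem _) hx, cls_rep]

lemma rep_add_sub_mem (a b : Disc B N) : rep (a + b) - (rep a + rep b) ∈ N := by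
  have h : a + b = cls B N (rep a + rep b) (add_mem (rep_mem a) (rep_mem b)) := by
    conv_lhs => rw [← cls_rep a, ← cls_rep b]
    rfl
  rw [h]
  exact rep_cls_sub_mem _

lemma rep_zero_mem : rep (0 : Disc B N) ∈ N := by
  have h : (0 : Disc B N) = cls B N 0 (zero_mem _) := rfl
  have := rep_cls_sub_mem (B := B) (N := N) (zero_mem (B.dualSubmodule N))
  rw [← h, sub_zero] at this
  exact this

lemma rep_mem_iff (a : Disc B N) : rep a ∈ N ↔ a = 0 := by
  constructor
  · intro h
    have h0 : cls B N 0 (zero_mem _) = a := (cls_eq_iff _ _).2 (by simpa using h)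
    exact h0.symm
  · rintro rfl; exact rep_zero_mem

/-- The character `a ↦ e((μ, a))` of the discriminant group. -/
def discChar {μ : V} (hμ : μ ∈ B.dualSubmodule N) : AddChar (Disc B N) ℂ where
  toFun a := e ((B μ (rep a) : ℚ) : ℂ)
  map_zero_eq_one' := e_ratCast_eq_one_iff.2 (mem_dualSubmodule_iff.1 hμ _ rep_zero_mem)
  map_add_eq_mul' a b := by
    obtain ⟨m, hm⟩ := mem_dualSubmodule_iff.1 hμ _ (rep_add_sub_mem a b)
    rw [← e_add, ← Rat.cast_add, ← map_add]
    exact e_ratCast_eq_of_sub m (by rw [← hm, map_sub])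

lemma discChar_apply {μ : V} (hμ : μ ∈ B.dualSubmodule N) (a : Disc B N) :
    discChar hμ a = e ((B μ (rep a) : ℚ) : ℂ) := rfl

end Disc

variable [FiniteDimensional ℚ V]

section Dual

variable {B : LinearMap.BilinForm ℚ V} (hB : B.Nondegenerate) (hs : B.IsSymm)
  {N : Submodule ℤ V} (hfg : N.FG) (hspan : Submodule.span ℚ (N : Set V) = ⊤)

include hB hfg hspan

lemma dualSubmodule_fg : (B.dualSubmodule N).FG := by
  obtain ⟨b, rfl⟩ := exists_basis_span_eq hfg hspan
  rw [LinearMap.BilinForm.dualSubmodule_span_of_basis (R := ℤ) B hB b]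
  exact Submodule.fg_span (Set.finite_range _)

lemma span_dualSubmodule : Submodule.span ℚ (B.dualSubmodule N : Set V) = ⊤ := by
  obtain ⟨b, rfl⟩ := exists_basis_span_eq hfg hspan
  rw [LinearMap.BilinForm.dualSubmodule_span_of_basis (R := ℤ) B hB b,
    Submodule.span_span_of_tower, Basis.span_eq]

include hs in
lemma dualSubmodule_dualSubmodule : B.dualSubmodule (B.dualSubmodule N) = N := by
  obtain ⟨b, rfl⟩ := exists_basis_span_eq hfg hspan
  exact LinearMap.BilinForm.dualSubmodule_dualSubmodule_of_basis B hB hs b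

/-- Every integral functional on `N ∩ P`, for a subspace `P`, is induced by a vector of the dual
lattice of `N`. -/
lemma exists_mem_dualSubmodule_of_integral (P : Submodule ℚ V) (x : V)
    (hx : ∀ y ∈ N, y ∈ P → ∃ m : ℤ, B x y = m) :
    ∃ u ∈ B.dualSubmodule N, ∀ y ∈ P, B u y = B x y := by
  have htf : Module.IsTorsionFree ℤ V := Module.IsTorsionFree.trans_faithfulSMul ℤ ℚ V
  have hfin : Module.Finite ℤ N := Module.Finite.iff_fg.2 hfg
  let P' : Submodule ℤ N := (P.restrictScalars ℤ).comap N.subtype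
  have hP' : ∀ y : N, y ∈ P' ↔ (y : V) ∈ P := fun _ => Iff.rfl
  -- P is a rational subspace, so N ∩ P is primitive in N. The quotient is then free, and N ∩ P is a
  -- direct summand.
  have htf' : Module.IsTorsionFree ℤ (N ⧸ P') := by
    rw [Module.isTorsionFree_iff_smul_eq_zero]
    intro r m h
    obtain ⟨y, rfl⟩ := Submodule.Quotient.mk_surjective P' m
    by_cases hr : r = 0
    · exact Or.inl hr
    refine Or.inr ?_
    rw [← Submodule.Quotient.mk_smul, Submodule.Quotient.mk_eq_zero, hP'] at h
    rw [Submodule.Quotient.mk_eq_zero, hP']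
    have h2 : ((r : ℚ)) • (y : V) ∈ P := by
      rw [Int.cast_smul_eq_zsmul]; exact h
    exact (P.smul_mem_iff (by exact_mod_cast hr)).1 h2
  have hfree : Module.Free ℤ (N ⧸ P') := Module.free_of_finite_type_torsion_free'
  obtain ⟨s, hs⟩ := LinearMap.exists_rightInverse_of_surjective P'.mkQ
    (LinearMap.range_eq_top.2 P'.mkQ_surjective)
  have hr : ∀ y : N, y - s (P'.mkQ y) ∈ P' := fun y => by
    rw [← Submodule.Quotient.mk_eq_zero, Submodule.Quotient.mk_sub, sub_eq_zero]
    exact (LinearMap.congr_fun hs (P'.mkQ y)).symm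
  -- Pairing with x after projecting N onto N ∩ P; it is integral on all of N by `hx`.
  let f : N →ₗ[ℤ] ℚ := ((B x).restrictScalars ℤ) ∘ₗ N.subtype ∘ₗ
    (LinearMap.id - s ∘ₗ P'.mkQ)
  have hf : ∀ y : N, f y = B x ((y - s (P'.mkQ y) : N) : V) := fun _ => rfl
  obtain ⟨b, hb⟩ := exists_basis_span_eq hfg hspan
  have hbN : ∀ i, b i ∈ N := fun i => hb ▸ Submodule.subset_span ⟨i, rfl⟩
  let g : V →ₗ[ℚ] ℚ := b.constr ℚ fun i => f ⟨b i, hbN i⟩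
  have hg : ∀ y : N, g y = f y := by
    rintro ⟨y, hy⟩
    have hy' : y ∈ Submodule.span ℤ (Set.range b) := hb ▸ hy
    obtain ⟨c, hc⟩ := (Submodule.mem_span_range_iff_exists_fun ℤ).1 hy'
    have h1 : (⟨y, hy⟩ : N) = ∑ i, c i • ⟨b i, hbN i⟩ := by
      ext; simp [hc]
    rw [h1, map_sum]
    simp only [Submodule.coe_sum, Submodule.coe_smul, map_sum, map_zsmul]
    exact Finset.sum_congr rfl fun i _ => by rw [Basis.constr_basis]
  let u : V := (B.toDual hB).symm g
  have hu : ∀ y, B u y = g y := fun y => LinearMap.BilinForm.apply_toDual_symm_apply ..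
  refine ⟨u, mem_dualSubmodule_iff.2 fun y hy => ?_, fun y hy => ?_⟩
  · rw [hu, hg ⟨y, hy⟩, hf]
    exact hx _ (Subtype.prop _) (hr _)
  -- The two functionals agree on N ∩ P, and clearing denominators extends this to P.
  · obtain ⟨k, hk, hky⟩ := exists_zsmul_mem hspan y
    have hkP : k • y ∈ P := by
      rw [← Int.cast_smul_eq_zsmul ℚ]; exact P.smul_mem _ hy
    have h1 : (P'.mkQ ⟨k • y, hky⟩) = 0 := (Submodule.Quotient.mk_eq_zero _).2 hkP
    have h2 : B u (k • y) = B x (k • y) := by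
      rw [hu, hg ⟨k • y, hky⟩, hf, h1, map_zero, sub_zero]
    rw [map_zsmul, map_zsmul] at h2
    exact smul_right_injective ℚ hk h2

lemma finite_disc : Finite (Disc B N) := by
  have : Module.Finite ℤ (B.dualSubmodule N) :=
    Module.Finite.iff_fg.2 (dualSubmodule_fg hB hfg hspan)
  refine Module.finite_of_fg_torsion _ fun {a} => ?_
  obtain ⟨k, hk, hka⟩ := exists_zsmul_mem hspan (rep a)
  refine ⟨⟨k, mem_nonZeroDivisors_of_ne_zero hk⟩, ?_⟩
  rw [← cls_rep a]
  change Submodule.Quotient.mk (k • _) = _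
  rw [Submodule.Quotient.mk_eq_zero]
  exact hka

include hs in
-- Orthogonality of characters. The character of μ is trivial exactly when μ pairs integrally with
-- N^∨, that is, when μ lies in N^∨∨ = N.
lemma sum_discChar [Fintype (Disc B N)] {μ : V} (hμ : μ ∈ B.dualSubmodule N) :
    (μ ∈ N → ∑ a : Disc B N, e ((B μ (rep a) : ℚ) : ℂ) = Fintype.card (Disc B N)) ∧
      (μ ∉ N → ∑ a : Disc B N, e ((B μ (rep a) : ℚ) : ℂ) = 0) := by
  classical
  simp_rw [← discChar_apply hμ]
  rw [AddChar.sum_eq_ite]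
  have key : discChar hμ = 0 ↔ μ ∈ N := by
    constructor
    · intro h
      rw [← dualSubmodule_dualSubmodule hB hs hfg hspan]
      refine mem_dualSubmodule_iff.2 fun y hy => ?_
      have h1 : discChar hμ (cls B N y hy) = 1 := by rw [h]; rfl
      rw [discChar_apply, e_ratCast_eq_one_iff] at h1
      obtain ⟨m, hm⟩ := h1
      obtain ⟨k, hk⟩ := mem_dualSubmodule_iff.1 hμ _ (rep_cls_sub_mem hy)
      rw [map_sub, hm] at hk
      exact ⟨m - k, by push_cast; linarith⟩
    · intro h
      ext a
      rw [discChar_apply, AddChar.zero_apply, e_ratCast_eq_one_iff, hs.eq]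
      exact mem_dualSubmodule_iff.1 (rep_mem a) _ h
  exact ⟨fun h => by rw [if_pos (key.2 h)], fun h => by rw [if_neg (mt key.1 h)]⟩

end Dual
end Lattice
end
end ThetaProduct

namespace ThetaProduct

noncomputable section

open Module

set_option linter.unusedSectionVars false

/-! ### The lattices L^* and K, and the definiteness of K. -/

namespace EvenLattice

variable {V : Type*} [AddCommGroup V] [Module ℚ V] (L : EvenLattice V) (I : Submodule ℤ V)

lemma lat_le_dual : L.lat ≤ L.form.dualSubmodule L.lat := fun x hx =>
  mem_dualSubmodule_iff.2 fun y hy => L.integral x hx y hy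

lemma neg_dualSubmodule {W : Type*} [AddCommGroup W] [Module ℚ W] (B : LinearMap.BilinForm ℚ W)
    (N : Submodule ℤ W) : (-B).dualSubmodule N = B.dualSubmodule N :=
  le_antisymm (by simpa using dualSubmodule_le_neg (-B) N) (dualSubmodule_le_neg B N)

lemma formK_mk (x y : L.perp I) :
    L.formK I (Submodule.Quotient.mk x) (Submodule.Quotient.mk y) = L.form x y := rfl

lemma formK_isSymm : (L.formK I).IsSymm := ⟨fun a b => by
  obtain ⟨x, rfl⟩ := Submodule.Quotient.mk_surjective _ a
  obtain ⟨y, rfl⟩ := Submodule.Quotient.mk_surjective _ b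
  rw [formK_mk, formK_mk, L.symm.eq]⟩

lemma mem_perp_iff {x : V} : x ∈ L.perp I ↔ ∀ y ∈ I, L.form y x = 0 := by
  constructor
  · exact fun h y hy => h y (Submodule.subset_span hy)
  · intro h y hy
    change L.form y x = 0
    induction hy using Submodule.span_induction with
    | mem y hy => exact h y hy
    | zero => simp
    | add y z _ _ h1 h2 => simp [h1, h2]
    | smul q y _ h1 => simp [h1]

lemma form_eq_zero_of_mem_perp {x y : V} (hx : x ∈ L.perp I) (hy : y ∈ IQ I) :
    L.form x y = 0 := by
  rw [L.symm.eq]; exact hx y hy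

lemma mk_eq_mk_iff (x y : L.perp I) :
    (Submodule.Quotient.mk x : L.KQ I) = Submodule.Quotient.mk y ↔ (x : V) - y ∈ IQ I :=
  Submodule.Quotient.eq _

lemma lat_le_Lstar : L.lat ≤ L.Lstar I := le_sup_left

lemma Istar_le_Lstar : L.Istar I ≤ L.Lstar I := le_sup_right

lemma Lstar_le_dual : L.Lstar I ≤ L.form.dualSubmodule L.lat :=
  sup_le L.lat_le_dual inf_le_right

lemma dual_Lstar_le_dual :
    L.form.dualSubmodule (L.Lstar I) ≤ L.form.dualSubmodule L.lat := fun _ hx y hy =>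
  hx y (L.lat_le_Lstar I hy)

/-- Passing from L to L^* only adds the condition of integrality on I^*, which lies in I_ℚ and is
orthogonal to y. -/
lemma mem_dual_Lstar_of_mem_perp {y : V} (hy : y ∈ L.form.dualSubmodule L.lat)
    (hyp : y ∈ L.perp I) : y ∈ L.form.dualSubmodule (L.Lstar I) := by
  rw [mem_dualSubmodule_iff]
  intro z hz
  obtain ⟨a, ha, b, hb, rfl⟩ := Submodule.mem_sup.1 hz
  rw [map_add, L.form_eq_zero_of_mem_perp I hyp hb.1, add_zero]
  exact mem_dualSubmodule_iff.1 hy a ha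

variable [FiniteDimensional ℚ V]

lemma finite_A : Finite L.A := finite_disc L.nondegenerate L.fg L.span_eq_top

lemma Lstar_fg : (L.Lstar I).FG := by
  have h := dualSubmodule_fg L.nondegenerate L.fg L.span_eq_top
  have : IsNoetherian ℤ (L.form.dualSubmodule L.lat) :=
    isNoetherian_of_fg_of_noetherian _ h
  have : IsNoetherian ℤ (L.Lstar I) := isNoetherian_of_le (L.Lstar_le_dual I)
  exact (isNoetherian_submodule.1 this) _ le_rfl

lemma span_Lstar : Submodule.span ℚ (L.Lstar I : Set V) = ⊤ :=
  span_eq_top_of_le (L.lat_le_Lstar I) L.span_eq_top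

variable {L I} (hI : L.IsMaximalIsotropic I)

include hI

lemma IQ_le_perp : IQ I ≤ L.perp I := by
  rw [Submodule.span_le]
  exact fun x hx => (L.mem_perp_iff I).2 fun y hy => hI.isotropic y hy x hx

/-- I^* pairs integrally with L because it lies in L^∨, and it is isotropic. -/
lemma Lstar_le_dual_Lstar : L.Lstar I ≤ L.form.dualSubmodule (L.Lstar I) := by
  intro x hx
  rw [mem_dualSubmodule_iff]
  intro y hy
  obtain ⟨a, ha, b, hb, rfl⟩ := Submodule.mem_sup.1 hx
  obtain ⟨c, hc, d, hd, rfl⟩ := Submodule.mem_sup.1 hy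
  obtain ⟨m₁, h₁⟩ := L.integral a ha c hc
  obtain ⟨m₂, h₂⟩ := mem_dualSubmodule_iff.1 hd.2 a ha
  obtain ⟨m₃, h₃⟩ := mem_dualSubmodule_iff.1 hb.2 c hc
  have h₄ : L.form b d = 0 := IQ_le_perp hI hd.1 b hb.1
  rw [L.symm.eq] at h₂
  exact ⟨m₁ + m₂ + m₃, by simp [h₁, h₂, h₃, h₄]⟩

/-- Two vectors of L^∨ with the same image in K_ℚ differ by an element of I_ℚ ∩ L^∨ = I^*. This
makes A_{L^*} → A_K well defined and injective. -/
lemma mk_mem_K_iff {y : V} (hy : y ∈ L.form.dualSubmodule L.lat) (hyp : y ∈ L.perp I) :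
    (Submodule.Quotient.mk ⟨y, hyp⟩ : L.KQ I) ∈ L.K I ↔ y ∈ L.Lstar I := by
  constructor
  · rintro ⟨x, hx, hxy⟩
    have h : (x : V) - y ∈ IQ I := (L.mk_eq_mk_iff I x ⟨y, hyp⟩).1 hxy
    have h2 : (x : V) - y ∈ L.Istar I := ⟨h, sub_mem (L.lat_le_dual hx) hy⟩
    have h3 := sub_mem (L.lat_le_Lstar I hx) (L.Istar_le_Lstar I h2)
    simpa using h3
  · intro h
    obtain ⟨a, ha, b, hb, hab⟩ := Submodule.mem_sup.1 h
    have h1 : a = y - b := by rw [← hab]; abel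
    have h2 : a ∈ L.perp I := h1 ▸ sub_mem hyp (IQ_le_perp hI hb.1)
    refine ⟨⟨a, h2⟩, ha, (L.mk_eq_mk_iff I _ _).2 ?_⟩
    change a - y ∈ IQ I
    rw [← hab, sub_add_cancel_left]
    exact neg_mem hb.1

/-- Every class of `A_{L^*}` is represented by a vector orthogonal to `I`. -/
lemma exists_perp_representative {x : V} (hx : x ∈ L.form.dualSubmodule (L.Lstar I)) :
    ∃ y : L.perp I, (y : V) ∈ L.form.dualSubmodule (L.Lstar I) ∧ (y : V) - x ∈ L.Lstar I := by
  have hfg := L.Lstar_fg I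
  have hsp := L.span_Lstar I
  -- The extension lemma is applied to the lattice (L^*)^∨, which meets I_ℚ inside I^*, where x
  -- pairs integrally. So u lies in (L^*)^∨∨ = L^*, and x - u is orthogonal to I.
  obtain ⟨u, hu, hux⟩ := exists_mem_dualSubmodule_of_integral L.nondegenerate
    (dualSubmodule_fg L.nondegenerate hfg hsp) (span_dualSubmodule L.nondegenerate hfg hsp)
    (IQ I) x (fun y hy hyI => mem_dualSubmodule_iff.1 hx y
      (L.Istar_le_Lstar I ⟨hyI, L.dual_Lstar_le_dual I hy⟩))
  rw [dualSubmodule_dualSubmodule L.nondegenerate L.symm hfg hsp] at hu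
  refine ⟨⟨x - u, fun y hy => ?_⟩, sub_mem hx (Lstar_le_dual_Lstar hI hu), ?_⟩
  · change L.form y (x - u) = 0
    rw [L.symm.eq, map_sub, LinearMap.sub_apply, hux y hy, sub_self]
  · change x - u - x ∈ _
    rw [sub_sub_cancel_left]
    exact neg_mem hu

/-- Every vector of the dual lattice of `K` comes from a vector of `(L^*)^∨` orthogonal to `I`. -/
lemma exists_lift_dual_K {z : L.KQ I} (hz : z ∈ (L.formK I).dualSubmodule (L.K I)) :
    ∃ y : L.perp I, (y : V) ∈ L.form.dualSubmodule (L.Lstar I) ∧ Submodule.Quotient.mk y = z := by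
  obtain ⟨x, rfl⟩ := Submodule.Quotient.mk_surjective _ z
  -- Since x pairs integrally with L ∩ I^⊥, some u in L^∨ has the same pairing with I_ℚ^⊥; then u -
  -- x lies in I_ℚ^⊥⊥ = I_ℚ.
  obtain ⟨u, hu, hux⟩ := exists_mem_dualSubmodule_of_integral L.nondegenerate L.fg L.span_eq_top
    (L.perp I) x (fun y hy hyp => mem_dualSubmodule_iff.1 hz _ ⟨⟨y, hyp⟩, hy, rfl⟩)
  have h : u - x ∈ IQ I := by
    rw [← LinearMap.BilinForm.orthogonal_orthogonal L.nondegenerate L.symm.isRefl (IQ I)]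
    intro y hy
    change L.form y (u - x) = 0
    rw [L.symm.eq, map_sub, LinearMap.sub_apply, hux y hy, sub_self]
  have hup : u ∈ L.perp I := by
    have := add_mem (IQ_le_perp hI h) x.2
    rwa [sub_add_cancel] at this
  exact ⟨⟨u, hup⟩, L.mem_dual_Lstar_of_mem_perp I hu hup, (L.mk_eq_mk_iff I _ _).2 h⟩

lemma finrank_IQ : finrank ℚ (IQ I) = L.sigPos := by
  have htf : Module.IsTorsionFree ℤ V := Module.IsTorsionFree.trans_faithfulSMul ℤ ℚ V
  have : Module.Finite ℤ L.lat := Module.Finite.iff_fg.2 L.fg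
  have : IsNoetherian ℤ I := isNoetherian_of_le hI.le
  rw [← hI.rank]
  let b := Module.finBasis ℤ I
  have hli : LinearIndependent ℚ fun i => (b i : V) := by
    rw [← LinearIndependent.iff_fractionRing ℤ ℚ]
    exact b.linearIndependent.map' I.subtype (Submodule.ker_subtype I)
  have hspan : Submodule.span ℚ (Set.range fun i => (b i : V)) = IQ I := by
    have h1 : Submodule.span ℤ (Set.range fun i => (b i : V)) = I := by
      have := congrArg (Submodule.map I.subtype) b.span_eq
      rw [Submodule.map_span, ← Set.range_comp, Submodule.map_top, Submodule.range_subtype] at this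
      exact this
    rw [← Submodule.span_span_of_tower ℤ ℚ, h1]
  rw [← hspan, finrank_span_eq_card hli, Fintype.card_fin]

omit hI in
lemma sigPos_add_sigNeg : L.sigPos + L.sigNeg = finrank ℚ V := by
  have : Invertible (2 : ℚ) := invertibleOfNonzero two_ne_zero
  have h := QuadraticForm.sigPos_add_sigNeg_add_radical (Q := L.form.toQuadraticMap)
  have h2 : (L.form.toQuadraticMap).radical = ⊥ := by
    rw [QuadraticMap.radical_eq_ker_associated,
      QuadraticMap.associated_left_inverse ℚ L.symm.eq]
    exact L.nondegenerate.ker_eq_bot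
  rw [h2, finrank_bot, add_zero] at h
  exact h

/-- Otherwise I_ℚ + ℚx would be a subspace of dimension p + 1 on which the form is nonnegative,
which is too large for signature (p, q). -/
lemma form_neg_of_mem_perp {x : V} (hx : x ∈ L.perp I) (hxI : x ∉ IQ I) : L.form x x < 0 := by
  by_contra hneg
  push Not at hneg
  have h0 : ∀ w ∈ IQ I ⊔ Submodule.span ℚ {x}, (-L.form.toQuadraticMap) w ≤ 0 := by
    intro w hw
    obtain ⟨i, hi, y, hy, rfl⟩ := Submodule.mem_sup.1 hw
    obtain ⟨c, rfl⟩ := Submodule.mem_span_singleton.1 hy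
    have h1 : L.form i i = 0 := IQ_le_perp hI hi i hi
    have h2 : L.form i x = 0 := hx i hi
    have h3 : L.form x i = 0 := L.form_eq_zero_of_mem_perp I hx hi
    simp [LinearMap.BilinMap.toQuadraticMap_apply, h1, h2, h3]
    nlinarith [mul_nonneg (mul_self_nonneg c) hneg]
  -- Applied to the negated form, whose positive index is q, this reads q + (p + 1) ≤ p + q.
  have h := QuadraticForm.sigPos_add_finrank_le_of_nonpos h0
  rw [Submodule.finrank_sup_span_singleton hxI, finrank_IQ hI, sigPos_neg,
    ← sigPos_add_sigNeg (L := L), sigNeg] at h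
  omega

lemma negFormK_posDef (z : L.KQ I) (hz : z ≠ 0) : 0 < (-L.formK I) z z := by
  obtain ⟨x, rfl⟩ := Submodule.Quotient.mk_surjective _ z
  have h : (x : V) ∉ IQ I := fun h => hz ((Submodule.Quotient.mk_eq_zero _).2 h)
  have := form_neg_of_mem_perp hI x.2 h
  rw [LinearMap.neg_apply, LinearMap.neg_apply, formK_mk]
  linarith

/-- dim K_ℚ = (p + q) - 2p. This matches the weight of the theta series with that of the forms. -/
lemma sigma_eq : L.sigma = -(finrank ℚ (L.KQ I) : ℤ) := by
  have h1 : finrank ℚ (L.KQ I) + finrank ℚ ((IQ I).submoduleOf (L.perp I)) =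
      finrank ℚ (L.perp I) := Submodule.finrank_quotient_add_finrank _
  have h2 : finrank ℚ ((IQ I).submoduleOf (L.perp I)) = L.sigPos := by
    rw [← finrank_IQ hI]
    exact (Submodule.submoduleOfEquivOfLe (IQ_le_perp hI)).finrank_eq
  have h3 := LinearMap.BilinForm.finrank_orthogonal L.nondegenerate (IQ I)
  rw [finrank_IQ hI] at h3
  have h4 := sigPos_add_sigNeg (L := L)
  have h6 : L.sigma = (L.sigPos : ℤ) - L.sigNeg := rfl
  have h5 : finrank ℚ (L.perp I) = finrank ℚ V - L.sigPos := h3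
  omega

omit hI

lemma K_fg : (L.K I).FG := by
  have : Module.Finite ℤ L.lat := Module.Finite.iff_fg.2 L.fg
  refine Submodule.FG.map _ ?_
  rw [← Module.Finite.iff_fg]
  let f : (L.lat.comap ((L.perp I).subtype.restrictScalars ℤ)) →ₗ[ℤ] L.lat :=
    ((L.perp I).subtype.restrictScalars ℤ).restrict fun _ hx => hx
  have : IsNoetherian ℤ (L.lat.comap ((L.perp I).subtype.restrictScalars ℤ)) :=
    isNoetherian_of_injective f fun a b hab => by
      ext
      exact congrArg (fun t : L.lat => (t : V)) hab
  infer_instance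

lemma span_K : Submodule.span ℚ (L.K I : Set (L.KQ I)) = ⊤ := by
  rw [eq_top_iff]
  rintro z -
  obtain ⟨x, rfl⟩ := Submodule.Quotient.mk_surjective _ z
  obtain ⟨k, hk, hkx⟩ := exists_zsmul_mem L.span_eq_top (x : V)
  have h : (Submodule.Quotient.mk (k • x) : L.KQ I) ∈ L.K I := ⟨k • x, hkx, rfl⟩
  have h2 := Submodule.smul_mem _ ((k : ℚ)⁻¹) (Submodule.subset_span (R := ℚ) h)
  rwa [Submodule.Quotient.mk_smul, ← Int.cast_smul_eq_zsmul ℚ, smul_smul,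
    inv_mul_cancel₀ (by exact_mod_cast hk), one_smul] at h2

end EvenLattice
end
end ThetaProduct

namespace ThetaProduct

noncomputable section

open Module

set_option linter.unusedSectionVars false

/-! ### The components θ_a as series over K^∨, and their behaviour under T. -/

namespace EvenLattice

open Classical in
/-- The pairing `⟨e_a↓^L_K, Θ_{K⁺}⟩`. -/
def thetaComponent {V : Type*} [AddCommGroup V] [Module ℚ V] (L : EvenLattice V)
    (I : Submodule ℤ V) (a : L.A) (τ : ℍ) : ℂ :=
  L.contractTheta I τ (L.pushK I (Finsupp.single a 1))

variable {V : Type*} [AddCommGroup V] [Module ℚ V] {L : EvenLattice V} {I : Submodule ℤ V}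

/-- The vector `z` of `K_ℚ` is the reduction of a vector of `(L^*)^∨ ∩ I_ℚ^⊥` that is congruent to
`a` modulo `L^*`. -/
def Represents (a : L.A) (z : L.KQ I) : Prop :=
  ∃ y : L.perp I, (y : V) ∈ L.form.dualSubmodule (L.Lstar I) ∧ (y : V) - rep a ∈ L.Lstar I ∧
    Submodule.Quotient.mk y = z

/-- The exponent of the theta series of `K⁺` at `z`. -/
def expo (z : L.KQ I) : ℚ := (-L.formK I) z z / 2

lemma expo_mk (y : L.perp I) : expo (Submodule.Quotient.mk y : L.KQ I) = -(L.form y y / 2) := by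
  simp [expo, formK_mk, neg_div]

variable [FiniteDimensional ℚ V] (hI : L.IsMaximalIsotropic I)

include hI

lemma Represents.rep_mem {a : L.A} {z : L.KQ I} (h : Represents a z) :
    rep a ∈ L.form.dualSubmodule (L.Lstar I) := by
  obtain ⟨y, hy, hya, -⟩ := h
  have := sub_mem hy (Lstar_le_dual_Lstar hI hya)
  rwa [sub_sub_cancel] at this

/-- For fixed a, the represented vectors form one coset of K: the index set of a coset theta series.
-/
lemma represents_iff_sub_mem_K {a : L.A} {y : L.perp I}
    (hy : (y : V) ∈ L.form.dualSubmodule (L.Lstar I)) (hya : (y : V) - rep a ∈ L.Lstar I)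
    (z : L.KQ I) : Represents a z ↔ z - Submodule.Quotient.mk y ∈ L.K I := by
  constructor
  · rintro ⟨y', hy', hya', rfl⟩
    rw [← Submodule.Quotient.mk_sub]
    refine (mk_mem_K_iff hI (L.dual_Lstar_le_dual I (sub_mem hy' hy)) (y' - y).2).2 ?_
    have := sub_mem hya' hya
    rwa [sub_sub_sub_cancel_right] at this
  · rintro ⟨x, hx, hxz⟩
    have hx' := L.lat_le_Lstar I hx
    refine ⟨y + x, add_mem hy (Lstar_le_dual_Lstar hI hx'), ?_, ?_⟩
    · have := add_mem hya hx'
      rwa [sub_add_eq_add_sub] at this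
    · rw [Submodule.Quotient.mk_add]
      change _ + ((Submodule.mkQ _) x) = _
      have : (Submodule.mkQ ((IQ I).submoduleOf (L.perp I))) x = z - Submodule.Quotient.mk y := hxz
      rw [this]
      abel

/-- For fixed z, the classes a that it represents form one coset of L^*/L. The finite Fourier sums
over A_L run over this coset. -/
lemma represents_mk_iff {a : L.A} {y : L.perp I}
    (hy : (y : V) ∈ L.form.dualSubmodule (L.Lstar I)) :
    Represents a (Submodule.Quotient.mk y : L.KQ I) ↔ rep a - y ∈ L.Lstar I := by
  constructor
  · rintro ⟨y', hy', hya', h⟩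
    have h1 : (y' : V) - y ∈ L.Istar I :=
      ⟨(L.mk_eq_mk_iff I y' y).1 h, L.dual_Lstar_le_dual I (sub_mem hy' hy)⟩
    have := sub_mem (L.Istar_le_Lstar I h1) hya'
    rwa [sub_sub_sub_cancel_left] at this
  · intro h
    refine ⟨y, hy, ?_, rfl⟩
    rw [← neg_sub]
    exact neg_mem h

/-- Independence of the chosen representative, by `mk_mem_K_iff`. -/
lemma discIso_cls (y : L.perp I) (hy : (y : V) ∈ L.form.dualSubmodule (L.Lstar I)) :
    L.discIso I (cls L.form (L.Lstar I) y hy) =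
      cls (L.formK I) (L.K I) (Submodule.Quotient.mk y) (L.mk_mem_dual_K I y hy) := by
  have h : ∃ (y' : L.perp I) (hy' : (y' : V) ∈ L.form.dualSubmodule (L.Lstar I)),
      cls L.form (L.Lstar I) y' hy' = cls L.form (L.Lstar I) y hy := ⟨y, hy, rfl⟩
  rw [discIso, dif_pos h, cls_eq_cls_iff, ← Submodule.Quotient.mk_sub]
  have h1 := h.choose_spec.choose
  have h2 := (cls_eq_cls_iff _ _).1 h.choose_spec.choose_spec
  exact (mk_mem_K_iff hI (L.dual_Lstar_le_dual I (sub_mem h1 hy)) (h.choose - y).2).2 h2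

open Classical in
-- The index set K^∨ is common to all a, which permits summing over a under the series. Both sides
-- vanish if a is not orthogonal to L^*/L.
lemma thetaComponent_eq_tsum (a : L.A) (τ : ℍ) :
    L.thetaComponent I a τ = ∑' z : (-L.formK I).dualSubmodule (L.K I),
      if Represents a (z : L.KQ I) then e ((expo (z : L.KQ I) : ℂ) * (τ : ℂ)) else 0 := by
  by_cases ha : rep a ∈ L.form.dualSubmodule (L.Lstar I)
  · obtain ⟨y, hy, hya⟩ := exists_perp_representative hI ha
    have h1 : cls L.form (L.Lstar I) (rep a) ha = cls L.form (L.Lstar I) y hy :=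
      ((cls_eq_cls_iff _ _).2 hya).symm
    have h2 : L.thetaComponent I a τ = theta (-L.formK I) (L.K I) τ
        (discNeg (L.formK I) (L.K I) (cls (L.formK I) (L.K I) (Submodule.Quotient.mk y)
          (L.mk_mem_dual_K I y hy))) := by
      rw [← discIso_cls hI y hy, ← h1, thetaComponent, pushK, LinearMap.comp_apply, pushforward,
        Finsupp.linearCombination_single, dif_pos ha, one_smul, Finsupp.lmapDomain_apply,
        Finsupp.mapDomain_single, contractTheta, Finsupp.linearCombination_single, one_smul]
    rw [h2, theta]
    have h3 : ∀ z : (-L.formK I).dualSubmodule (L.K I),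
        (Submodule.Quotient.mk z : Disc (-L.formK I) (L.K I)) =
          discNeg (L.formK I) (L.K I) (cls (L.formK I) (L.K I) (Submodule.Quotient.mk y)
          (L.mk_mem_dual_K I y hy)) ↔ Represents a (z : L.KQ I) := fun z => by
      rw [represents_iff_sub_mem_K hI hy hya]
      exact Submodule.Quotient.eq _
    refine (tsum_subtype {z : (-L.formK I).dualSubmodule (L.K I) |
      (Submodule.Quotient.mk z : Disc (-L.formK I) (L.K I)) =
          discNeg (L.formK I) (L.K I) (cls (L.formK I) (L.K I) (Submodule.Quotient.mk y)
          (L.mk_mem_dual_K I y hy))}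
      (fun z => e (((expo (z : L.KQ I) : ℚ) : ℂ) * (τ : ℂ)))).trans ?_
    refine tsum_congr fun z => ?_
    rw [Set.indicator_apply]
    simp only [Set.mem_ofPred_eq, h3]
  · have h2 : L.thetaComponent I a τ = 0 := by
      rw [thetaComponent, pushK, LinearMap.comp_apply, pushforward,
        Finsupp.linearCombination_single, dif_neg ha, smul_zero, map_zero, map_zero]
    rw [h2, eq_comm]
    convert tsum_zero with z
    exact if_neg fun h => ha (h.rep_mem hI)

lemma even_Lstar {t : V} (ht : t ∈ L.Lstar I) : ∃ m : ℤ, L.form t t = 2 * m := by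
  obtain ⟨a, ha, b, hb, rfl⟩ := Submodule.mem_sup.1 ht
  obtain ⟨m, hm⟩ := L.even a ha
  obtain ⟨k, hk⟩ := mem_dualSubmodule_iff.1 hb.2 a ha
  have h1 : L.form b b = 0 := IQ_le_perp hI hb.1 b hb.1
  have h2 : L.form a b = k := by rw [L.symm.eq]; exact hk
  refine ⟨m + k, ?_⟩
  simp [hm, hk, h1, h2]
  ring

/-- A lift y of z differs from `rep a` by an element of the even lattice L^*, which pairs integrally
with `rep a`, so y and `rep a` have equal norms modulo 2ℤ. The sign comes from K⁺ = K(-1). -/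
lemma Represents.exists_expo_eq {a : L.A} {z : L.KQ I} (h : Represents a z) :
    ∃ m : ℤ, expo z = -(L.form (rep a) (rep a) / 2) + m := by
  have ha := h.rep_mem hI
  obtain ⟨y, hy, hya, rfl⟩ := h
  obtain ⟨m, hm⟩ := even_Lstar hI hya
  obtain ⟨k, hk⟩ := mem_dualSubmodule_iff.1 ha _ hya
  have h2 : L.form ((y : V) - rep a) (rep a) = k := by rw [L.symm.eq]; exact hk
  refine ⟨-m - k, ?_⟩
  rw [expo_mk]
  have h3 : L.form y y = L.form (rep a) (rep a) + 2 * k + 2 * m := by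
    have h1 : (y : V) = rep a + (y - rep a) := by abel
    rw [h1]
    generalize (y : V) - rep a = t at *
    simp only [map_add, LinearMap.add_apply, hm, hk, h2]
    ring
  rw [h3]
  push_cast
  ring

lemma expo_nonneg (z : L.KQ I) : 0 ≤ expo z := by
  by_cases hz : z = 0
  · simp [hz, expo]
  · exact (half_pos (negFormK_posDef hI z hz)).le

lemma negFormK_isSymm : (-L.formK I).IsSymm := (L.formK_isSymm I).neg

lemma negFormK_nondegenerate : (-L.formK I).Nondegenerate :=
  nondegenerate_of_posDef _ (negFormK_isSymm hI) (negFormK_posDef hI)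

lemma summable_exp_neg_expo {a : ℝ} (ha : 0 < a) :
    Summable fun z : (-L.formK I).dualSubmodule (L.K I) =>
      Real.exp (-a * (expo (z : L.KQ I) : ℚ)) := by
  have hnd := negFormK_nondegenerate hI
  refine (summable_exp_neg_form (-L.formK I) (negFormK_isSymm hI) (negFormK_posDef hI)
    (dualSubmodule_fg hnd K_fg span_K) (span_dualSubmodule hnd K_fg span_K) 0
    (half_pos ha)).congr fun z => ?_
  rw [zero_add, expo]
  congr 1
  push_cast
  ring

lemma norm_e_expo (z : L.KQ I) (τ : ℍ) :
    ‖e ((expo z : ℂ) * (τ : ℂ))‖ = Real.exp (-(2 * Real.pi * τ.im) * (expo z : ℚ)) := by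
  rw [norm_e]
  congr 1
  have : ((expo z : ℂ) * (τ : ℂ)).im = (expo z : ℚ) * τ.im := by
    rw [show (expo z : ℂ) = (((expo z : ℚ) : ℝ) : ℂ) by push_cast; rfl, Complex.im_ofReal_mul]
    rfl
  rw [this]
  ring

lemma summable_norm_e_expo (τ : ℍ) :
    Summable fun z : (-L.formK I).dualSubmodule (L.K I) =>
      ‖e ((expo (z : L.KQ I) : ℂ) * (τ : ℂ))‖ := by
  simp_rw [norm_e_expo hI]
  exact summable_exp_neg_expo hI (by have := τ.im_pos; positivity)

open Classical in
lemma summable_norm_thetaComponent (a : L.A) (τ : ℍ) :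
    Summable fun z : (-L.formK I).dualSubmodule (L.K I) =>
      ‖if Represents a (z : L.KQ I) then e ((expo (z : L.KQ I) : ℂ) * (τ : ℂ)) else 0‖ :=
  Summable.of_nonneg_of_le (fun _ => norm_nonneg _)
    (fun z => by split_ifs <;> simp) (summable_norm_e_expo hI τ)

lemma thetaComponent_vadd (a : L.A) (τ : ℍ) :
    L.thetaComponent I a ((1 : ℝ) +ᵥ τ) =
      e (-(L.form (rep a) (rep a) / 2 : ℚ)) * L.thetaComponent I a τ := by
  classical
  rw [thetaComponent_eq_tsum hI, thetaComponent_eq_tsum hI, ← tsum_mul_left]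
  refine tsum_congr fun z => ?_
  split_ifs with h
  · obtain ⟨m, hm⟩ := h.exists_expo_eq hI
    rw [UpperHalfPlane.coe_vadd, mul_add, e_add, Complex.ofReal_one, mul_one]
    congr 1
    rw [← Rat.cast_neg]
    exact e_ratCast_eq_of_sub m (by rw [hm]; ring)
  · rw [mul_zero]

end EvenLattice
end
end ThetaProduct

namespace ThetaProduct

noncomputable section

open Module

set_option linter.unusedSectionVars false

/-! ### Finite Fourier analysis on A_L, and θ_a under S up to a constant. -/

namespace EvenLattice

variable {V : Type*} [AddCommGroup V] [Module ℚ V] {L : EvenLattice V} {I : Submodule ℤ V}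
  [FiniteDimensional ℚ V] [Fintype L.A] (hI : L.IsMaximalIsotropic I)

include hI

/-- The translation of `A_L` by the class of a vector `x` of `L^∨`. -/
lemma rep_add_cls (a : L.A) {x : V} (hx : x ∈ L.form.dualSubmodule L.lat) :
    rep (a + cls L.form L.lat x hx) - (rep a + x) ∈ L.Lstar I := by
  refine L.lat_le_Lstar I ?_
  have := add_mem (rep_add_sub_mem a (cls L.form L.lat x hx)) (rep_cls_sub_mem hx)
  convert this using 1
  abel

open Classical in
/-- The order of `L^*/L`. -/
def gluingOrder (L : EvenLattice V) [Fintype L.A] (I : Submodule ℤ V) : ℕ :=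
  (Finset.univ.filter fun a : L.A => rep a ∈ L.Lstar I).card

omit hI in
lemma gluingOrder_pos : 0 < gluingOrder L I := by
  classical
  exact Finset.card_pos.2 ⟨0, by simpa using L.lat_le_Lstar I rep_zero_mem⟩

open Classical in
lemma card_coset {x : V} (hx : x ∈ L.form.dualSubmodule L.lat) :
    (Finset.univ.filter fun a : L.A => rep a - x ∈ L.Lstar I).card = gluingOrder L I := by
  refine Finset.card_bij (fun a _ => a + cls L.form L.lat (-x) (neg_mem hx)) ?_ ?_ ?_
  · intro a ha
    simp only [Finset.mem_filter, Finset.mem_univ, true_and] at ha ⊢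
    have := add_mem (rep_add_cls hI a (neg_mem hx)) ha
    convert this using 1
    abel
  · intro a _ b _ h
    exact add_right_cancel h
  · intro b hb
    simp only [Finset.mem_filter, Finset.mem_univ, true_and] at hb ⊢
    refine ⟨b + cls L.form L.lat x hx, ?_, ?_⟩
    · have := add_mem (rep_add_cls hI b hx) hb
      convert this using 1
      abel
    · have : cls L.form L.lat (-x) (neg_mem hx) = -cls L.form L.lat x hx := rfl
      rw [this, add_neg_cancel_right]

open Classical in
-- Choose t in L^* with (l, t) not integral. Translation by t permutes the coset and multiplies the
-- sum by e(-(l, t)) ≠ 1.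
lemma sum_char_coset_eq_zero {l : V} (hl : l ∈ L.form.dualSubmodule L.lat)
    (hl' : l ∉ L.form.dualSubmodule (L.Lstar I)) (x : V) :
    ∑ a : L.A, (if rep a - x ∈ L.Lstar I then e (-(L.form l (rep a) : ℚ)) else 0) = 0 := by
  rw [mem_dualSubmodule_iff] at hl'
  push Not at hl'
  obtain ⟨t, ht, hlt⟩ := hl'
  have htd := L.Lstar_le_dual I ht
  set S := ∑ a : L.A, (if rep a - x ∈ L.Lstar I then e (-(L.form l (rep a) : ℚ)) else 0) with hS
  have h : S = e (-(L.form l t : ℚ)) * S := by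
    conv_lhs => rw [hS, ← Equiv.sum_comp (Equiv.addRight (cls L.form L.lat t htd))]
    rw [hS, Finset.mul_sum]
    refine Finset.sum_congr rfl fun a _ => ?_
    rw [Equiv.coe_addRight]
    have h1 := rep_add_cls hI a htd
    have h2 : rep (a + cls L.form L.lat t htd) - x ∈ L.Lstar I ↔ rep a - x ∈ L.Lstar I := by
      have h3 := add_mem h1 ht
      rw [← Submodule.sub_mem_iff_left _ h3]
      convert Iff.rfl using 2
      abel
    simp only [h2]
    split_ifs
    · obtain ⟨m, hm⟩ := mem_dualSubmodule_iff.1 hl _ (by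
        have := add_mem (rep_add_sub_mem a (cls L.form L.lat t htd)) (rep_cls_sub_mem htd)
        exact this)
      rw [← e_add, ← Rat.cast_neg, ← Rat.cast_neg, ← Rat.cast_neg, ← Rat.cast_add]
      refine e_ratCast_eq_of_sub (-m) ?_
      simp only [map_sub, map_add] at hm
      push_cast
      linarith
    · rw [mul_zero]
  have h1 : e (-(L.form l t : ℚ)) ≠ 1 := by
    rw [← Rat.cast_neg, Ne, e_ratCast_eq_one_iff]
    rintro ⟨m, hm⟩
    exact hlt (-m) (by push_cast; linarith)
  have h2 : (1 - e (-(L.form l t : ℚ))) * S = 0 := by linear_combination h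
  exact (mul_eq_zero.1 h2).resolve_left (sub_ne_zero.2 h1.symm)

open Classical in
/-- The Fourier transform of the indicator function of a coset of `L^*/L`. -/
lemma sum_char_represents {l : L.A} {y : L.perp I}
    (hy : (y : V) ∈ L.form.dualSubmodule (L.Lstar I)) (hyl : (y : V) - rep l ∈ L.Lstar I)
    {z : L.KQ I} (hz : z ∈ (L.formK I).dualSubmodule (L.K I)) :
    ∑ a : L.A, (if Represents a z then e (-(L.form (rep l) (rep a) : ℚ)) else 0) =
      gluingOrder L I * e (-(L.formK I (Submodule.Quotient.mk y) z : ℚ)) := by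
  obtain ⟨x, hx, rfl⟩ := exists_lift_dual_K hI hz
  simp only [represents_mk_iff hI hx]
  rw [← card_coset hI (L.dual_Lstar_le_dual I hx), ← Finset.sum_filter, ← nsmul_eq_mul]
  -- Since l is orthogonal to L^*/L, its character is constant on the coset.
  refine Finset.sum_eq_card_nsmul fun a ha => ?_
  simp only [Finset.mem_filter, Finset.mem_univ, true_and] at ha
  have hl : rep l ∈ L.form.dualSubmodule (L.Lstar I) := by
    have := sub_mem hy (Lstar_le_dual_Lstar hI hyl)
    rwa [sub_sub_cancel] at this
  obtain ⟨m, hm⟩ := mem_dualSubmodule_iff.1 hl _ ha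
  obtain ⟨k, hk⟩ := mem_dualSubmodule_iff.1 hx _ hyl
  rw [L.symm.eq] at hk
  rw [formK_mk, ← Rat.cast_neg, ← Rat.cast_neg]
  refine e_ratCast_eq_of_sub (k - m) ?_
  simp only [map_sub, LinearMap.sub_apply] at hm hk
  push_cast
  linarith

open Classical in
lemma sum_char_represents_eq_zero {l : L.A}
    (hl : rep l ∉ L.form.dualSubmodule (L.Lstar I))
    {z : L.KQ I} (hz : z ∈ (L.formK I).dualSubmodule (L.K I)) :
    ∑ a : L.A, (if Represents a z then e (-(L.form (rep l) (rep a) : ℚ)) else 0) = 0 := by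
  obtain ⟨x, hx, rfl⟩ := exists_lift_dual_K hI hz
  simp only [represents_mk_iff hI hx]
  exact sum_char_coset_eq_zero hI (ThetaProduct.rep_mem l) hl x

omit [Fintype L.A] in
-- The form of θ_a that occurs on the right-hand side of `exists_theta_inversion`.
lemma thetaComponent_eq_tsum_K {a : L.A} {y : L.perp I}
    (hy : (y : V) ∈ L.form.dualSubmodule (L.Lstar I)) (hya : (y : V) - rep a ∈ L.Lstar I)
    (τ : ℍ) : L.thetaComponent I a τ =
      ∑' k : L.K I, e ((expo ((Submodule.Quotient.mk y : L.KQ I) + (k : L.KQ I)) : ℂ) * (τ : ℂ)) := by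
  classical
  have hmem : ∀ k : L.K I, ((Submodule.Quotient.mk y : L.KQ I) + (k : L.KQ I)) ∈
      (-L.formK I).dualSubmodule (L.K I) := fun k => by
    have h : Represents a ((Submodule.Quotient.mk y : L.KQ I) + (k : L.KQ I)) :=
      (represents_iff_sub_mem_K hI hy hya _).2 (by simp)
    obtain ⟨x, hx, -, hxz⟩ := h
    rw [neg_dualSubmodule, ← hxz]
    exact L.mk_mem_dual_K I x hx
  rw [thetaComponent_eq_tsum hI]
  let g : L.K I → (-L.formK I).dualSubmodule (L.K I) := fun k => ⟨_, hmem k⟩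
  have hg : Function.Injective g := fun k k' h => by
    have := congrArg Subtype.val h
    exact Subtype.ext (add_left_cancel this)
  rw [← hg.tsum_eq]
  · refine tsum_congr fun k => ?_
    rw [if_pos ((represents_iff_sub_mem_K hI hy hya _).2 (by simp [g]))]
  · intro z hz
    have h : Represents a (z : L.KQ I) := by
      by_contra h
      exact hz (if_neg h)
    refine ⟨⟨_, (represents_iff_sub_mem_K hI hy hya _).1 h⟩, Subtype.ext ?_⟩
    simp [g]

/-- The behaviour of the theta components under `S`, up to the value of the constant. -/
lemma exists_sum_thetaComponent_S : ∃ c : ℝ, 0 < c ∧ ∀ (τ : ℍ) (l : L.A),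
    ∑ a : L.A, e (-(L.form (rep l) (rep a) : ℚ)) * L.thetaComponent I a (ModularGroup.S • τ) =
      c * (-Complex.I * τ) ^ (finrank ℚ (L.KQ I) / 2 : ℂ) * L.thetaComponent I l τ := by
  classical
  obtain ⟨c, hc, h⟩ := exists_theta_inversion (-L.formK I) (negFormK_isSymm hI)
    (negFormK_posDef hI) (K_fg (L := L) (I := I)) span_K
  refine ⟨gluingOrder L I * c, mul_pos (by exact_mod_cast gluingOrder_pos) hc, fun τ l => ?_⟩
  have hS : ((ModularGroup.S • τ : ℍ) : ℂ) = -1 / (τ : ℂ) := by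
    rw [UpperHalfPlane.modular_S_smul]
    change (-(τ : ℂ))⁻¹ = _
    rw [inv_neg, neg_div, one_div]
  -- The finite sum over A_L moves inside the series, where it becomes the Fourier transform of the
  -- indicator of a coset.
  have h1 : ∑ a : L.A, e (-(L.form (rep l) (rep a) : ℚ)) *
      L.thetaComponent I a (ModularGroup.S • τ) =
      ∑' z : (-L.formK I).dualSubmodule (L.K I), e ((expo (z : L.KQ I) : ℂ) * (-1 / (τ : ℂ))) *
        ∑ a : L.A, (if Represents a (z : L.KQ I) then
          e (-(L.form (rep l) (rep a) : ℚ)) else 0) := by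
    simp_rw [thetaComponent_eq_tsum hI, ← tsum_mul_left]
    rw [← Summable.tsum_finsetSum fun a _ =>
      ((summable_norm_thetaComponent hI a (ModularGroup.S • τ)).of_norm.mul_left _)]
    refine tsum_congr fun z => ?_
    rw [Finset.mul_sum, hS]
    refine Finset.sum_congr rfl fun a _ => ?_
    split_ifs
    · rw [mul_comm]
    · simp
  rw [h1]
  have hdual : ∀ z : (-L.formK I).dualSubmodule (L.K I),
      (z : L.KQ I) ∈ (L.formK I).dualSubmodule (L.K I) := fun z => by
    rw [← neg_dualSubmodule]; exact z.2
  by_cases hl : rep l ∈ L.form.dualSubmodule (L.Lstar I)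
  · obtain ⟨y, hy, hyl⟩ := exists_perp_representative hI hl
    simp_rw [sum_char_represents hI hy hyl (hdual _)]
    -- The shift is -y because inversion is applied to the negated form: the two signs cancel in
    -- e(-(y, z)).
    have h2 := h τ (-Submodule.Quotient.mk y)
    have h3 : ∑' k : L.K I, e ((((-L.formK I) (-(Submodule.Quotient.mk y : L.KQ I) + k)
        (-(Submodule.Quotient.mk y : L.KQ I) + k) / 2 : ℚ) : ℂ) * (τ : ℂ)) = L.thetaComponent I l τ := by
      rw [thetaComponent_eq_tsum_K hI hy hyl, ← (Equiv.neg _).tsum_eq]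
      refine tsum_congr fun k => ?_
      rw [expo]
      congr 3
      have : -(Submodule.Quotient.mk y : L.KQ I) + (((Equiv.neg (L.K I)) k : L.K I) : L.KQ I) =
          -(Submodule.Quotient.mk y + (k : L.KQ I)) := by
        rw [Equiv.neg_apply, NegMemClass.coe_neg, neg_add]
      rw [this]
      simp only [map_neg, LinearMap.neg_apply, neg_neg]
    rw [h3] at h2
    push_cast
    rw [mul_assoc (gluingOrder L I : ℂ), mul_assoc (gluingOrder L I : ℂ), ← h2, ← tsum_mul_left]
    refine tsum_congr fun z => ?_
    rw [expo]
    simp only [map_neg, LinearMap.neg_apply, neg_neg]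
    ring
  · simp_rw [sum_char_represents_eq_zero hI hl (hdual _)]
    have h2 : L.thetaComponent I l τ = 0 := by
      rw [thetaComponent_eq_tsum hI]
      convert tsum_zero with z
      exact if_neg fun h => hl (h.rep_mem hI)
    simp [h2]

end EvenLattice
end
end ThetaProduct

namespace ThetaProduct

noncomputable section

open Module

set_option linter.unusedSectionVars false

/-! ### The exact constant, and the invariance of ξ(f). -/

namespace EvenLattice

variable {V : Type*} [AddCommGroup V] [Module ℚ V] {L : EvenLattice V} {I : Submodule ℤ V}

lemma xi_eq_sum [Fintype L.A] (f : ℍ → (L.A →₀ ℂ)) (τ : ℍ) :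
    L.xi I f τ = ∑ a : L.A, f τ a * L.thetaComponent I a τ := by
  classical
  have h : f τ = ∑ a : L.A, f τ a • Finsupp.single a (1 : ℂ) := by
    ext b
    simp
  rw [xi]
  conv_lhs => rw [h]
  simp only [map_sum, map_smul, smul_eq_mul]
  rfl

lemma weilT_apply [Fintype L.A] (v : L.A →₀ ℂ) (b : L.A) :
    weilT L.form L.lat v b = e ((L.form (rep b) (rep b) / 2 : ℚ)) * v b := by
  classical
  rw [weilT, Finsupp.linearCombination_apply, Finsupp.sum_fintype _ _ (by simp)]
  simp [Finsupp.finsetSum_apply, Finsupp.single_apply, mul_comm]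

lemma weilS_apply [Fintype L.A] (σ : ℤ) (v : L.A →₀ ℂ) (b : L.A) :
    weilS L.form L.lat σ v b = (e (-(σ : ℂ) / 8) / (Real.sqrt (Nat.card L.A) : ℂ)) *
      ∑ a : L.A, v a * e (-(L.form (rep a) (rep b) : ℚ)) := by
  classical
  rw [weilS, Finsupp.linearCombination_apply, Finsupp.sum_fintype _ _ (by simp)]
  simp only [Finsupp.finsetSum_apply, Finsupp.smul_apply, smul_eq_mul,
    finsum_eq_sum_of_fintype, Finsupp.single_apply, mul_ite, mul_one, mul_zero,
    Finset.sum_ite_eq', Finset.mem_univ, if_true]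
  rw [Finset.mul_sum]
  exact Finset.sum_congr rfl fun a _ => by ring

variable [FiniteDimensional ℚ V] (hI : L.IsMaximalIsotropic I)

include hI

/-- At τ = i the terms of the series are nonnegative reals, and z = 0 contributes a positive one. -/
lemma thetaComponent_zero_I_ne_zero : L.thetaComponent I 0 UpperHalfPlane.I ≠ 0 := by
  classical
  have hterm : ∀ z : (-L.formK I).dualSubmodule (L.K I),
      (if Represents (0 : L.A) (z : L.KQ I) then
        e ((expo (z : L.KQ I) : ℂ) * ((UpperHalfPlane.I : ℍ) : ℂ)) else 0) =
      (((if Represents (0 : L.A) (z : L.KQ I) then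
        Real.exp (-(2 * Real.pi) * (expo (z : L.KQ I) : ℚ)) else 0 : ℝ)) : ℂ) := fun z => by
    split_ifs
    · rw [e, Complex.ofReal_exp]
      congr 1
      rw [UpperHalfPlane.coe_I]
      push_cast
      linear_combination (2 * (Real.pi : ℂ) * (expo (z : L.KQ I) : ℂ)) * Complex.I_sq
    · simp
  rw [thetaComponent_eq_tsum hI]
  simp_rw [hterm]
  rw [← Complex.ofReal_tsum, Complex.ofReal_ne_zero]
  have h0 : Represents (0 : L.A) (0 : L.KQ I) :=
    ⟨0, zero_mem _, by
      rw [Submodule.coe_zero, zero_sub]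
      exact neg_mem (L.lat_le_Lstar I rep_zero_mem), rfl⟩
  refine (Summable.tsum_pos ?_ (fun z => ?_) (0 : (-L.formK I).dualSubmodule (L.K I)) ?_).ne'
  · refine Summable.of_nonneg_of_le (fun z => ?_) (fun z => ?_)
      (summable_exp_neg_expo hI Real.two_pi_pos)
    · split_ifs <;> positivity
    · split_ifs
      · exact le_rfl
      · positivity
  · split_ifs <;> positivity
  · rw [if_pos (by exact h0)]
    positivity

variable [Fintype L.A]

/-- The behaviour of the theta components under `S`. -/
lemma sum_thetaComponent_S (τ : ℍ) (l : L.A) :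
    ∑ a : L.A, e (-(L.form (rep l) (rep a) : ℚ)) * L.thetaComponent I a (ModularGroup.S • τ) =
      Real.sqrt (Nat.card L.A) * (-Complex.I * τ) ^ (finrank ℚ (L.KQ I) / 2 : ℂ) *
        L.thetaComponent I l τ := by
  obtain ⟨c, hc, h⟩ := exists_sum_thetaComponent_S hI
  suffices hcA : c = Real.sqrt (Nat.card L.A) by rw [← hcA]; exact h τ l
  have hSI : ModularGroup.S • UpperHalfPlane.I = UpperHalfPlane.I := by
    apply UpperHalfPlane.ext
    rw [UpperHalfPlane.modular_S_smul]
    change (-((UpperHalfPlane.I : ℍ) : ℂ))⁻¹ = _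
    rw [UpperHalfPlane.coe_I]
    simp
  -- S fixes i, where -iτ = 1, so the values v_a = θ_a(i) form an eigenvector of the Fourier matrix
  -- with eigenvalue c. Row 0 gives ∑ v_a = c v_0. Summing all rows gives |A_L| v_0 by
  -- orthogonality, and also c ∑ v_a = c² v_0.
  have h1 : ∀ l : L.A, ∑ a : L.A, e (-(L.form (rep l) (rep a) : ℚ)) *
      L.thetaComponent I a UpperHalfPlane.I = c * L.thetaComponent I l UpperHalfPlane.I :=
    fun l => by
      have := h UpperHalfPlane.I l
      rw [hSI, UpperHalfPlane.coe_I] at this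
      simpa using this
  obtain ⟨v, hv⟩ : ∃ v : L.A → ℂ, ∀ a, L.thetaComponent I a UpperHalfPlane.I = v a :=
    ⟨_, fun _ => rfl⟩
  simp_rw [hv] at h1
  have h2 : ∑ a : L.A, v a = c * v 0 := by
    rw [← h1 0]
    refine Finset.sum_congr rfl fun a _ => ?_
    have : e (-(L.form (rep (0 : L.A)) (rep a) : ℚ)) = 1 := by
      rw [← Rat.cast_neg, e_ratCast_eq_one_iff]
      obtain ⟨m, hm⟩ := mem_dualSubmodule_iff.1 (rep_mem a) _ rep_zero_mem
      rw [L.symm.eq] at hm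
      exact ⟨-m, by rw [hm]; simp⟩
    rw [this, one_mul]
  have h3 : ∑ l : L.A, ∑ a : L.A, e (-(L.form (rep l) (rep a) : ℚ)) * v a =
      (Fintype.card L.A : ℂ) * v 0 := by
    rw [Finset.sum_comm, Finset.sum_eq_single 0]
    · rw [← Finset.sum_mul]
      have hmem := neg_mem (rep_mem (0 : L.A))
      rw [← (sum_discChar L.nondegenerate L.symm L.fg L.span_eq_top hmem).1
        (neg_mem rep_zero_mem)]
      congr 1
      refine Finset.sum_congr rfl fun a _ => ?_
      rw [map_neg, LinearMap.neg_apply, Rat.cast_neg, L.symm.eq]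
    · intro b _ hb
      rw [← Finset.sum_mul]
      have hmem := neg_mem (rep_mem b)
      have := (sum_discChar L.nondegenerate L.symm L.fg L.span_eq_top hmem).2
        (fun hn => hb ((rep_mem_iff b).1 (by simpa using neg_mem hn)))
      simp only [map_neg, LinearMap.neg_apply, Rat.cast_neg] at this
      rw [show ∑ l : L.A, e (-(L.form (rep l) (rep b) : ℚ)) = 0 by
        rw [← this]
        exact Finset.sum_congr rfl fun a _ => by rw [L.symm.eq], zero_mul]
    · simp
  simp_rw [h1] at h3
  rw [← Finset.mul_sum, h2, ← mul_assoc] at h3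
  have h4 := mul_right_cancel₀ (hv 0 ▸ thetaComponent_zero_I_ne_zero hI) h3
  have h5 : c * c = (Nat.card L.A : ℝ) := by
    rw [Nat.card_eq_fintype_card]
    exact_mod_cast h4
  rw [← h5, Real.sqrt_mul_self hc.le]

omit [Fintype L.A] in
lemma xi_vadd {f : ℍ → (L.A →₀ ℂ)} (hf : f ∈ L.forms) (τ : ℍ) :
    L.xi I f ((1 : ℝ) +ᵥ τ) = L.xi I f τ := by
  have := L.finite_A
  have := Fintype.ofFinite L.A
  have h := hf.modular Mp2Z.T (weilT L.form L.lat) (Submonoid.subset_closure (by simp)) τ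
  have h1 : Mp2Z.T.mat • τ = (1 : ℝ) +ᵥ τ := UpperHalfPlane.modular_T_smul τ
  rw [h1, show Mp2Z.T.phi τ = 1 from rfl, one_zpow, one_smul] at h
  rw [xi_eq_sum, xi_eq_sum, h]
  refine Finset.sum_congr rfl fun a _ => ?_
  rw [weilT_apply, thetaComponent_vadd hI]
  have : e ((L.form (rep a) (rep a) / 2 : ℚ)) * e (-(L.form (rep a) (rep a) / 2 : ℚ)) = 1 := by
    rw [← e_add, add_neg_cancel, e_zero]
  linear_combination (f τ a * L.thetaComponent I a τ) * this

omit hI [FiniteDimensional ℚ V] [Fintype L.A] in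
-- Here e(-1/8) is the principal square root of -i. As arg(-i) = -π/2 and arg τ lies in [0, π], the
-- principal logarithms add without correction.
lemma neg_I_mul_cpow_half (τ : ℍ) (n : ℕ) :
    (-Complex.I * τ : ℂ) ^ (n / 2 : ℂ) = (e (-1 / 8) * (τ : ℂ) ^ (1 / 2 : ℂ)) ^ n := by
  have hτ : (τ : ℂ) ≠ 0 := τ.ne_zero
  have hI0 : -Complex.I ≠ 0 := neg_ne_zero.2 Complex.I_ne_zero
  have h1 := Complex.arg_nonneg_iff.2 (show 0 ≤ (τ : ℂ).im from τ.im_pos.le)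
  have h2 := Complex.arg_le_pi (τ : ℂ)
  have h : Complex.log (-Complex.I * τ) = Complex.log (-Complex.I) + Complex.log τ :=
    Complex.log_mul hI0 hτ (by
      rw [Complex.arg_neg_I]
      constructor <;> linarith [Real.pi_pos])
  rw [Complex.cpow_def_of_ne_zero (mul_ne_zero hI0 hτ), Complex.cpow_def_of_ne_zero hτ, e,
    ← Complex.exp_add, ← Complex.exp_nat_mul, h, Complex.log_neg_I]
  congr 1
  ring

omit [Fintype L.A] in
lemma xi_S {f : ℍ → (L.A →₀ ℂ)} (hf : f ∈ L.forms) (τ : ℍ) :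
    L.xi I f (ModularGroup.S • τ) = L.xi I f τ := by
  have hfin := L.finite_A
  have := Fintype.ofFinite L.A
  have h := hf.modular Mp2Z.S (weilS L.form L.lat L.sigma) (Submonoid.subset_closure (by simp)) τ
  rw [show Mp2Z.S.mat = ModularGroup.S from rfl,
    show Mp2Z.S.phi τ = (τ : ℂ) ^ (1 / 2 : ℂ) from rfl] at h
  rw [xi_eq_sum, xi_eq_sum, h]
  set n := finrank ℚ (L.KQ I) with hn
  set s : ℂ := (Real.sqrt (Nat.card L.A) : ℂ) with hs
  have hs0 : s ≠ 0 := by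
    rw [hs, Complex.ofReal_ne_zero]
    exact (Real.sqrt_pos.2 (by exact_mod_cast Nat.card_pos)).ne'
  set t : ℂ := (τ : ℂ) ^ (1 / 2 : ℂ) with ht
  have ht0 : t ≠ 0 := Mp2Z.S.phi_ne_zero τ
  -- Because σ = -n, the powers of √τ, the eighth roots of unity and the factors √|A_L| cancel
  -- separately.
  have hfac : t ^ L.sigma * (e (-(L.sigma : ℂ) / 8) / s) *
      (s * (-Complex.I * τ) ^ (n / 2 : ℂ)) = 1 := by
    have h1 : e (-(L.sigma : ℂ) / 8) * e (-1 / 8) ^ n = 1 := by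
      rw [e, e, ← Complex.exp_nat_mul, ← Complex.exp_add, sigma_eq hI]
      rw [Complex.exp_eq_one_iff]
      exact ⟨0, by push_cast; ring⟩
    have h2 : t ^ L.sigma * t ^ n = 1 := by
      rw [sigma_eq hI, ← zpow_natCast, ← zpow_add₀ ht0]
      simp [hn]
    rw [neg_I_mul_cpow_half, mul_pow, ← ht]
    calc _ = t ^ L.sigma * t ^ n * (e (-(L.sigma : ℂ) / 8) * e (-1 / 8) ^ n) * (s * s⁻¹) := by ring
      _ = 1 := by rw [h1, h2, mul_inv_cancel₀ hs0, one_mul, one_mul]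
  calc ∑ b : L.A, (t ^ L.sigma • weilS L.form L.lat L.sigma (f τ)) b *
        L.thetaComponent I b (ModularGroup.S • τ)
      = t ^ L.sigma * (e (-(L.sigma : ℂ) / 8) / s) * ∑ a : L.A, f τ a *
          ∑ b : L.A, e (-(L.form (rep a) (rep b) : ℚ)) *
            L.thetaComponent I b (ModularGroup.S • τ) := by
        simp only [Finsupp.smul_apply, weilS_apply, smul_eq_mul, Finset.mul_sum, Finset.sum_mul]
        rw [Finset.sum_comm]
        exact Finset.sum_congr rfl fun a _ => Finset.sum_congr rfl fun b _ => by ring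
    _ = ∑ a : L.A, f τ a * L.thetaComponent I a τ := by
        simp_rw [sum_thetaComponent_S hI]
        rw [Finset.mul_sum]
        refine Finset.sum_congr rfl fun a _ => ?_
        linear_combination (f τ a * L.thetaComponent I a τ) * hfac

omit [Fintype L.A] in
-- In weight 0 there is no automorphy factor, so invariance under T and S passes to products.
lemma xi_smul_of_mem_weilGraph {f : ℍ → (L.A →₀ ℂ)} (hf : f ∈ L.forms)
    {x : Mp2Z × Module.End ℂ (L.A →₀ ℂ)} (hx : x ∈ weilGraph L.form L.lat L.sigma) :
    ∀ τ : ℍ, L.xi I f (x.1.mat • τ) = L.xi I f τ := by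
  induction hx using Submonoid.closure_induction with
  | mem x hx =>
    intro τ
    rcases hx with rfl | rfl
    · exact (congrArg (L.xi I f) (UpperHalfPlane.modular_T_smul τ)).trans (xi_vadd hI hf τ)
    · exact xi_S hI hf τ
  | one => intro τ; simp
  | mul x y _ _ hx hy =>
    intro τ
    rw [Prod.fst_mul, Mp2Z.mul_mat, mul_smul, hx, hy]

end EvenLattice
end
end ThetaProduct

namespace ThetaProduct

noncomputable section

open Module

set_option linter.unusedSectionVars false

/-! ### q-expansions with coefficients in a subring of ℂ. -/

section QExpansion

/-- `g = ∑_{n ∈ r + ℤ} c(n) q^n` with coefficients in `S` and finitely many `c(n) ≠ 0` for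
negative `n`. -/
def HasQExp (S : Subring ℂ) (r : ℚ) (g : ℍ → ℂ) : Prop :=
  ∃ (N : ℤ) (c : ℕ → ℂ), (∀ m, c m ∈ S) ∧
    ∀ τ : ℍ, HasSum (fun m : ℕ => c m * e (((r + N + m : ℚ) : ℂ) * (τ : ℂ))) (g τ)

variable {S : Subring ℂ} {r s : ℚ} {g h : ℍ → ℂ}

/-- Cauchy product of absolutely convergent series; each new coefficient is a finite sum of
products, hence in S. -/
lemma HasQExp.mul (hg : HasQExp S r g) (hh : HasQExp S s h) :
    HasQExp S (r + s) fun τ => g τ * h τ := by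
  obtain ⟨N, c, hc, hcs⟩ := hg
  obtain ⟨M, d, hd, hds⟩ := hh
  refine ⟨N + M, fun m => ∑ p ∈ Finset.HasAntidiagonal.antidiagonal m, c p.1 * d p.2,
    fun m => sum_mem fun p _ => mul_mem (hc _) (hd _), fun τ => ?_⟩
  have h1 := (hcs τ).summable.norm
  have h2 := (hds τ).summable.norm
  change HasSum _ (g τ * h τ)
  rw [← (hcs τ).tsum_eq, ← (hds τ).tsum_eq,
    tsum_mul_tsum_eq_tsum_sum_antidiagonal_of_summable_norm h1 h2]
  have h3 := (summable_norm_sum_mul_antidiagonal_of_summable_norm h1 h2).of_norm.hasSum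
  refine h3.congr_fun fun m => ?_
  dsimp only
  rw [Finset.sum_mul]
  refine Finset.sum_congr rfl fun p hp => ?_
  rw [mul_mul_mul_comm, ← e_add]
  congr 2
  rw [← Finset.HasAntidiagonal.mem_antidiagonal.1 hp]
  push_cast
  ring

/-- Padding with zeros, so that two expansions can be added from a common starting exponent. -/
lemma HasQExp.lower {N : ℤ} {c : ℕ → ℂ} (hc : ∀ m, c m ∈ S)
    (hcs : ∀ τ : ℍ, HasSum (fun m : ℕ => c m * e (((r + N + m : ℚ) : ℂ) * (τ : ℂ))) (g τ))
    {M : ℤ} (hM : M ≤ N) : ∃ d : ℕ → ℂ, (∀ m, d m ∈ S) ∧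
      ∀ τ : ℍ, HasSum (fun m : ℕ => d m * e (((r + M + m : ℚ) : ℂ) * (τ : ℂ))) (g τ) := by
  obtain ⟨k, hk⟩ := Int.eq_ofNat_of_zero_le (sub_nonneg.2 hM)
  refine ⟨fun m => if k ≤ m then c (m - k) else 0, fun m => ?_, fun τ => ?_⟩
  · dsimp only
    split_ifs
    · exact hc _
    · exact zero_mem S
  · have hinj : Function.Injective fun m : ℕ => m + k := add_left_injective k
    rw [← hinj.hasSum_iff]
    · refine (hcs τ).congr_fun fun m => ?_
      have hN : (N : ℚ) = M + k := by
        have : N = M + k := by omega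
        exact_mod_cast this
      simp only [Function.comp_apply, Nat.le_add_left, if_true, Nat.add_sub_cancel]
      congr 3
      rw [hN]
      push_cast
      ring
    · intro m hm
      have hkm : ¬k ≤ m := fun hkm => hm ⟨m - k, Nat.sub_add_cancel hkm⟩
      simp only [hkm, if_false, zero_mul]

lemma HasQExp.add (hg : HasQExp S r g) (hh : HasQExp S r h) :
    HasQExp S r fun τ => g τ + h τ := by
  obtain ⟨N, c, hc, hcs⟩ := hg
  obtain ⟨M, d, hd, hds⟩ := hh
  obtain ⟨c', hc', hcs'⟩ := HasQExp.lower hc hcs (min_le_left N M)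
  obtain ⟨d', hd', hds'⟩ := HasQExp.lower hd hds (min_le_right N M)
  refine ⟨min N M, fun m => c' m + d' m, fun m => add_mem (hc' m) (hd' m), fun τ => ?_⟩
  simpa only [add_mul] using (hcs' τ).add (hds' τ)

lemma HasQExp.sum {ι : Type*} (t : Finset ι) {G : ι → ℍ → ℂ} (hG : ∀ i ∈ t, HasQExp S r (G i)) :
    HasQExp S r fun τ => ∑ i ∈ t, G i τ := by
  classical
  induction t using Finset.induction_on with
  | empty => exact ⟨0, 0, fun _ => zero_mem S, fun τ => by simp⟩
  | insert i t hi ih =>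
    simp_rw [Finset.sum_insert hi]
    exact (hG i (Finset.mem_insert_self i t)).add
      (ih fun j hj => hG j (Finset.mem_insert_of_mem hj))

/-- A series of powers of `q` is a `q`-expansion whose coefficients count the terms. -/
lemma hasQExp_of_hasSum {Z : Type*} (N : ℤ) (k : Z → ℕ)
    (hsum : ∀ τ : ℍ, HasSum (fun z : Z => e (((r + N + k z : ℚ) : ℂ) * (τ : ℂ))) (g τ)) :
    HasQExp S r g := by
  have hsig : ∀ τ : ℍ, HasSum (fun z : Σ m, {z : Z // k z = m} =>
      e (((r + N + k z.2.1 : ℚ) : ℂ) * (τ : ℂ))) (g τ) := fun τ =>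
    (Equiv.sigmaFiberEquiv k).hasSum_iff.2 (hsum τ)
  have hconst : ∀ (τ : ℍ) (m : ℕ), (fun z : {z : Z // k z = m} =>
      e (((r + N + k z.1 : ℚ) : ℂ) * (τ : ℂ))) =
        fun _ => e (((r + N + m : ℚ) : ℂ) * (τ : ℂ)) := fun τ m => by
    funext z
    rw [z.2]
  -- On a fibre of k the terms are a nonzero constant, so summability at τ = i forces the fibre to
  -- be finite.
  have hfin : ∀ m : ℕ, Finite {z : Z // k z = m} := fun m => by
    rw [← not_infinite_iff_finite]
    intro hinf
    have h1 : Summable fun z : {z : Z // k z = m} =>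
      e (((r + N + k z.1 : ℚ) : ℂ) * ((UpperHalfPlane.I : ℍ) : ℂ)) :=
      (hsig UpperHalfPlane.I).summable.sigma_factor m
    rw [hconst] at h1
    exact e_ne_zero _ ((summable_const_iff _).1 h1)
  refine ⟨N, fun m => (Nat.card {z : Z // k z = m} : ℂ), fun m => natCast_mem S _, fun τ => ?_⟩
  refine (hsig τ).sigma fun m => ?_
  have := Fintype.ofFinite {z : Z // k z = m}
  change HasSum (fun z : {z : Z // k z = m} => e (((r + N + k z.1 : ℚ) : ℂ) * (τ : ℂ))) _
  dsimp only
  rw [hconst, Nat.card_eq_fintype_card, ← nsmul_eq_mul, ← Finset.card_univ, ← Finset.sum_const]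
  exact hasSum_fintype _

variable {V : Type*} [AddCommGroup V] [Module ℚ V] {B : LinearMap.BilinForm ℚ V}
  {N : Submodule ℤ V} {f : ℍ → (Disc B N →₀ ℂ)}

lemma HasFourierExpansion.hasQExp {c : Disc B N → ℚ → ℂ} (hf : HasFourierExpansion B N f c)
    (hc : ∀ a n, c a n ∈ S) (a : Disc B N) :
    HasQExp S (B (rep a) (rep a) / 2) fun τ => f τ a := by
  obtain ⟨n₀, hn₀⟩ := hf.bddBelow
  set q := B (rep a) (rep a) / 2 with hq
  -- An exponent q + k that occurs is at least n₀, so k ≥ M.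
  set M : ℤ := ⌊n₀ - q⌋ with hM
  refine ⟨M, fun m => c a (q + M + m), fun m => hc _ _, fun τ => ?_⟩
  have hinj : Function.Injective fun m : ℕ => (q + M + m : ℚ) := fun m m' h => by
    simpa using h
  have h1 := hf.hasSum a τ
  rw [← hinj.hasSum_iff] at h1
  · exact h1
  · intro n hn
    by_cases hcn : c a n = 0
    · rw [hcn, zero_mul]
    · exfalso
      obtain ⟨k, hk⟩ := hf.support a n hcn
      have hlt : n₀ ≤ n := by
        by_contra hlt
        exact hcn (hn₀ a n (not_le.1 hlt))
      have hMk : M ≤ k := by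
        rw [hM, Int.floor_le_iff]
        rw [hk] at hlt
        linarith
      obtain ⟨m, hm⟩ := Int.eq_ofNat_of_zero_le (sub_nonneg.2 hMk)
      refine hn ⟨m, ?_⟩
      have : (k : ℚ) = M + m := by
        have : k = M + m := by omega
        exact_mod_cast this
      change q + M + m = n
      rw [hk, this]
      ring

lemma exists_hasFourierExpansion [Finite (Disc B N)]
    (hf : ∀ a, HasQExp S (B (rep a) (rep a) / 2) fun τ => f τ a) :
    ∃ c, HasFourierExpansion B N f c ∧ ∀ a n, c a n ∈ S := by
  classical
  choose M c hc hcs using hf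
  let γ : Disc B N → ℕ → ℚ := fun a m => B (rep a) (rep a) / 2 + M a + m
  have hinj : ∀ a, Function.Injective (γ a) := fun a m m' h => by simpa [γ] using h
  let C : Disc B N → ℚ → ℂ := fun a => Function.extend (γ a) (c a) 0
  have hC : ∀ a m, C a (γ a m) = c a m := fun a m => (hinj a).extend_apply _ _ _
  have hC0 : ∀ a n, (¬∃ m, γ a m = n) → C a n = 0 := fun a n h =>
    Function.extend_apply' _ _ _ h
  refine ⟨C, ⟨fun a n hn => ?_, ?_, fun a τ => ?_⟩, fun a n => ?_⟩
  · by_cases h : ∃ m, γ a m = n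
    · obtain ⟨m, rfl⟩ := h
      exact ⟨M a + m, by simp [γ, add_assoc]⟩
    · exact absurd (hC0 a n h) hn
  -- Finiteness of the discriminant group gives one lower bound for all components.
  · obtain ⟨n₀, hn₀⟩ := (Set.finite_range fun a => γ a 0).bddBelow
    refine ⟨n₀, fun a n hn => hC0 a n ?_⟩
    rintro ⟨m, rfl⟩
    have h1 : n₀ ≤ γ a 0 := hn₀ ⟨a, rfl⟩
    have h2 : γ a 0 ≤ γ a m := by simp [γ]
    linarith
  · rw [← (hinj a).hasSum_iff]
    · refine (hcs a τ).congr_fun fun m => ?_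
      rw [Function.comp_apply, hC]
    · intro n hn
      rw [hC0 a n hn, zero_mul]
  · by_cases h : ∃ m, γ a m = n
    · obtain ⟨m, rfl⟩ := h
      rw [hC]; exact hc a m
    · rw [hC0 a n h]; exact zero_mem S

end QExpansion

/-! ### Expansions and holomorphy of θ_a and ξ(f); closure under the Θ-product. -/

namespace EvenLattice

variable {V : Type*} [AddCommGroup V] [Module ℚ V] {L : EvenLattice V} {I : Submodule ℤ V}
  [FiniteDimensional ℚ V] (hI : L.IsMaximalIsotropic I)

include hI

lemma thetaComponent_hasQExp (S : Subring ℂ) (a : L.A) :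
    HasQExp S (-(L.form (rep a) (rep a) / 2)) (L.thetaComponent I a) := by
  classical
  set q : ℚ := L.form (rep a) (rep a) / 2 with hq
  -- The exponents -q + k are nonnegative by definiteness of K⁺, so k ≥ ⌊q⌋.
  set N : ℤ := ⌊q⌋ with hN
  let Z := {z : (-L.formK I).dualSubmodule (L.K I) // Represents a (z : L.KQ I)}
  have hk : ∀ z : Z, ∃ m : ℕ, expo (z.1 : L.KQ I) = -q + N + m := fun z => by
    obtain ⟨k, hk⟩ := z.2.exists_expo_eq hI
    have h0 := expo_nonneg hI (z.1 : L.KQ I)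
    have hNk : N ≤ k := by
      rw [hN, Int.floor_le_iff]
      rw [hk] at h0
      linarith
    obtain ⟨m, hm⟩ := Int.eq_ofNat_of_zero_le (sub_nonneg.2 hNk)
    refine ⟨m, ?_⟩
    have : (k : ℚ) = N + m := by
      have : k = N + m := by omega
      exact_mod_cast this
    rw [hk, this]
    ring
  choose k hk using hk
  refine hasQExp_of_hasSum N k fun τ => ?_
  have h1 := (summable_norm_thetaComponent hI a τ).of_norm.hasSum
  rw [← thetaComponent_eq_tsum hI] at h1
  have hinj : Function.Injective (Subtype.val : Z → (-L.formK I).dualSubmodule (L.K I)) :=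
    Subtype.val_injective
  rw [← hinj.hasSum_iff] at h1
  · refine h1.congr_fun fun z => ?_
    rw [Function.comp_apply, if_pos z.2, ← hk z]
  · intro z hz
    exact if_neg fun h => hz ⟨⟨z, h⟩, rfl⟩

/-- On each half plane Im τ > ε the series is dominated by its absolute values at height ε, hence
converges to a holomorphic function. -/
lemma thetaComponent_mdifferentiable (a : L.A) : MDiff (L.thetaComponent I a) := by
  classical
  rw [UpperHalfPlane.mdifferentiable_iff]
  let F : (-L.formK I).dualSubmodule (L.K I) → ℂ → ℂ := fun z w =>
    if Represents a (z : L.KQ I) then e ((expo (z : L.KQ I) : ℂ) * w) else 0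
  have hF : ∀ z, Differentiable ℂ (F z) := fun z => by
    by_cases h : Represents a (z : L.KQ I)
    · simp only [F, h, if_true, e]
      fun_prop
    · simp only [F, h, if_false]
      fun_prop
  have hloc : ∀ ε : ℝ, 0 < ε →
      DifferentiableOn ℂ (fun w => ∑' z, F z w) {w : ℂ | ε < w.im} := fun ε hε => by
    refine Complex.differentiableOn_tsum_of_summable_norm
      (summable_exp_neg_expo hI (a := 2 * Real.pi * ε) (by positivity))
      (fun z => (hF z).differentiableOn) (isOpen_lt continuous_const Complex.continuous_im)
      fun z w hw => ?_
    have hw' : ε < w.im := hw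
    have hnn : (0 : ℝ) ≤ (expo (z : L.KQ I) : ℚ) := by exact_mod_cast expo_nonneg hI _
    by_cases h : Represents a (z : L.KQ I)
    · simp only [F, h, if_true]
      have him : ((expo (z : L.KQ I) : ℂ) * w).im = (expo (z : L.KQ I) : ℚ) * w.im := by
        rw [show (expo (z : L.KQ I) : ℂ) = (((expo (z : L.KQ I) : ℚ) : ℝ) : ℂ) by
          push_cast; rfl, Complex.im_ofReal_mul]
      rw [norm_e, him, Real.exp_le_exp]
      have := mul_le_mul_of_nonneg_left hw'.le (mul_nonneg Real.two_pi_pos.le hnn)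
      linarith
    · simp only [F, h, if_false, norm_zero]
      positivity
  intro w hw
  have hw' : 0 < w.im := hw
  have h1 : DifferentiableAt ℂ (fun w => ∑' z, F z w) w :=
    (hloc (w.im / 2) (half_pos hw')).differentiableAt
      ((isOpen_lt continuous_const Complex.continuous_im).mem_nhds (half_lt_self hw'))
  refine (h1.congr_of_eventuallyEq ?_).differentiableWithinAt
  filter_upwards [(isOpen_lt continuous_const Complex.continuous_im).mem_nhds hw'] with v hv
  rw [Function.comp_apply, thetaComponent_eq_tsum hI,
    UpperHalfPlane.ofComplex_apply_of_im_pos hv]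

/-- The exponents of f_a lie in q_L(a) + ℤ and those of θ_a in -q_L(a) + ℤ, so the products have
integral exponents. -/
lemma xi_hasQExp {S : Subring ℂ} {f : ℍ → (L.A →₀ ℂ)}
    (hf : ∀ a : L.A, HasQExp S (L.form (rep a) (rep a) / 2) fun τ => f τ a) :
    HasQExp S 0 (L.xi I f) := by
  have := L.finite_A
  have := Fintype.ofFinite L.A
  have h : L.xi I f = fun τ => ∑ a : L.A, f τ a * L.thetaComponent I a τ :=
    funext fun τ => xi_eq_sum f τ
  rw [h]
  refine HasQExp.sum _ fun a _ => ?_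
  have := (hf a).mul (thetaComponent_hasQExp hI S a)
  rwa [add_neg_cancel] at this

lemma xi_mdifferentiable {f : ℍ → (L.A →₀ ℂ)} (hf : ∀ a : L.A, MDiff (fun τ : ℍ => f τ a)) :
    MDiff (L.xi I f) := by
  have := L.finite_A
  have := Fintype.ofFinite L.A
  have h (a : L.A) : MDiff fun τ : ℍ => f τ a * L.thetaComponent I a τ :=
    (hf a).mul (thetaComponent_mdifferentiable hI a)
  simp_rw [UpperHalfPlane.mdifferentiable_iff] at h ⊢
  refine (DifferentiableOn.fun_sum (u := Finset.univ) fun a _ => h a).congr fun w _ => ?_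
  rw [Function.comp_apply, xi_eq_sum]
  rfl

lemma thetaMul_hasQExp {S : Subring ℂ} {f₁ f₂ : ℍ → (L.A →₀ ℂ)}
    (h₁ : ∀ a : L.A, HasQExp S (L.form (rep a) (rep a) / 2) fun τ => f₁ τ a)
    (h₂ : ∀ a : L.A, HasQExp S (L.form (rep a) (rep a) / 2) fun τ => f₂ τ a) (a : L.A) :
    HasQExp S (L.form (rep a) (rep a) / 2) fun τ => L.thetaMul I f₁ f₂ τ a := by
  have := (xi_hasQExp hI h₁).mul (h₂ a)
  rwa [zero_add] at this

lemma thetaMul_mem_forms {f₁ f₂ : ℍ → (L.A →₀ ℂ)} (h₁ : f₁ ∈ L.forms) (h₂ : f₂ ∈ L.forms) :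
    L.thetaMul I f₁ f₂ ∈ L.forms := by
  have := L.finite_A
  have hq : ∀ f ∈ L.forms, ∀ a : L.A,
      HasQExp ⊤ (L.form (rep a) (rep a) / 2) fun τ => f τ a := fun f hf a => by
    obtain ⟨c, hc⟩ := hf.meromorphic
    exact hc.hasQExp (fun _ _ => Subring.mem_top _) a
  refine ⟨fun a => (xi_mdifferentiable hI h₁.holo).mul (h₂.holo a), fun g ρg hg τ => ?_, ?_⟩
  · have h3 : L.xi I f₁ (g.mat • τ) = L.xi I f₁ τ := xi_smul_of_mem_weilGraph hI h₁ hg τ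
    change L.xi I f₁ (g.mat • τ) • f₂ (g.mat • τ) = _ • ρg (L.xi I f₁ τ • f₂ τ)
    rw [h3, h₂.modular g ρg hg, map_smul, smul_comm]
  · obtain ⟨c, hc, -⟩ := exists_hasFourierExpansion
      (thetaMul_hasQExp hI (hq f₁ h₁) (hq f₂ h₂))
    exact ⟨c, hc⟩

lemma thetaMul_mem_integralForms {f₁ f₂ : ℍ → (L.A →₀ ℂ)} (h₁ : f₁ ∈ L.integralForms)
    (h₂ : f₂ ∈ L.integralForms) : L.thetaMul I f₁ f₂ ∈ L.integralForms := by
  have := L.finite_A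
  have hq : ∀ f ∈ L.integralForms, ∀ a : L.A,
      -- The same expansion argument as for M^!(L), with the subring ℤ in place of ℂ.
      HasQExp (Int.castRingHom ℂ).range (L.form (rep a) (rep a) / 2) fun τ => f τ a :=
    fun f hf a => by
      obtain ⟨-, c, hc⟩ := hf
      exact hc.hasQExp (fun a n => RingHom.mem_range.2 ⟨c a n, rfl⟩) a
  refine ⟨thetaMul_mem_forms hI h₁.1 h₂.1, ?_⟩
  obtain ⟨c, hc, hcS⟩ := exists_hasFourierExpansion
    (thetaMul_hasQExp hI (hq f₁ h₁) (hq f₂ h₂))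
  choose d hd using hcS
  refine ⟨d, ?_⟩
  convert hc using 3
  exact hd _ _

end EvenLattice
end
end ThetaProduct

open ThetaProduct
/-- `M^!(L)'_ℤ` is closed under the `Θ`-product, and so it is a subring of the (non-unital)
ring `M^!(L)`. -/
theorem mainTheorem9 {V : Type*} [AddCommGroup V] [Module ℚ V] [FiniteDimensional ℚ V]
    (L : EvenLattice V) (p q : ℕ) (hp : L.sigPos = p) (hq : L.sigNeg = q) (hpq : p ≤ q)
    (I : Submodule ℤ V) (hI : L.IsMaximalIsotropic I) :
    (∀ f₁ f₂ : ℍ → (L.A →₀ ℂ), f₁ ∈ L.integralForms → f₂ ∈ L.integralForms →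
      L.thetaMul I f₁ f₂ ∈ L.integralForms) ∧
    ∃ M : NonUnitalSubring (L.ThetaAlgebra I), (∀ f, f ∈ M ↔ f ∈ L.forms) ∧
      ∃ R : NonUnitalSubring M, ∀ f : M, f ∈ R ↔ f.1 ∈ L.integralForms := by
  refine ⟨fun f₁ f₂ h₁ h₂ => EvenLattice.thetaMul_mem_integralForms hI h₁ h₂,
    { carrier := {f | f ∈ L.forms}
      zero_mem' := zero_mem L.forms
      add_mem' := fun h₁ h₂ => L.forms.add_mem h₁ h₂
      neg_mem' := fun h => L.forms.neg_mem h
      mul_mem' := fun h₁ h₂ => EvenLattice.thetaMul_mem_forms hI h₁ h₂ }, fun _ => Iff.rfl,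
    { carrier := {f | f.1 ∈ L.integralForms}
      zero_mem' := zero_mem L.integralForms
      add_mem' := fun h₁ h₂ => L.integralForms.add_mem h₁ h₂
      neg_mem' := fun h => L.integralForms.neg_mem h
      mul_mem' := fun h₁ h₂ => EvenLattice.thetaMul_mem_integralForms hI h₁ h₂ },
    fun _ => Iff.rfl⟩
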